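/- Let $P_0\subset\mathbb{R}^d$ be a (non-empty) polytope whose normal fan $\Delta=\mathcal{N}(P_0)=\{N_F(P_0): F \text{ a non-empty face of } P_0\}$, with $N_F(P)=\{x\in\mathbb{R}^d:\max_{y\in P}\langle x,y\rangle=\langle x,p\rangle\text{ for all }p\in F\}$, is simplicial, i.e. every cone of $\Delta$ is generated by linearly independent vectors. Let $\mathbf{v}_1,\dots,\mathbf{v}_n$ be the ray generators of $\Delta$: the one-dimensional cones of $\Delta$ are $\operatorname{pos}\{\mathbf{v}_1\},\dots,\operatorname{pos}\{\mathbf{v}_n\}$, each listed exactly once. Let $\mathcal{P}(\Delta)$ be the deformation cone of $\Delta$, the set of all non-empty polytopes $Q\subset\mathbb{R}^d$ such that every cone of $\mathcal{N}(Q)$ is a union of cones of $\Delta$, and let $h_Q(\mathbf{u})=\max_{x\in Q}\langle \mathbf{u},x\rangle$ be the support function. For a matrix $U\in\mathbb{R}^{m\times d}$ with rows $\mathbf{u}^{(1)},\dots,\mathbf{u}^{(m)}$ and $\mathbf{y}\in\mathbb{R}^m$ let $$\hat P^\Delta(U,\mathbf{y})=\operatorname*{argmin}_{Q\in\mathcal{P}(\Delta)}\frac1m\sum_{i=1}^m\bigl(h_Q(\mathbf{u}^{(i)})-y^{(i)}\bigr)^2$$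 be the set of all minimizers, and let $\mathcal{U}=\{U\in\mathbb{R}^{m\times d}: |\hat P^\Delta(U,\mathbf{y})|=1\text{ for all }\mathbf{y}\in\mathbb{R}^m\}$. For $\mathbf{u}\in\mathbb{R}^d$ let $\sigma\in\Delta$ be the unique cone with $\mathbf{u}\in\operatorname{relint}\sigma$, write $\sigma=\operatorname{pos}\{\mathbf{v}_k:k\in I_\sigma\}$ with $I_\sigma\subseteq[n]$ and $\mathbf{u}=\sum_{k\in I_\sigma}\lambda_k\mathbf{v}_k$, and define $[\mathbf{u}]\in\mathbb{R}^n$ by $[\mathbf{u}]_i=\lambda_i$ for $i\in I_\sigma$ and $[\mathbf{u}]_i=0$ otherwise. Let $G_U$ be the bipartite graph with vertex set $[n]\sqcup[m]$ in which $i\in[n]$ and $j\in[m]$ are joined by an edge if and only if $[\mathbf{u}^{(j)}]_i>0$. **Theorem 3.8.** If $m\ge n$, then $\mathcal{U}$ has non-empty interior in $\mathbb{R}^{m\times d}$. Moreover, for all $U\in\mathbb{R}^{m\times d}$ outside a set of Lebesgue measure zero, $U\in\mathcal{U}$ if and only if $G_U$ has a matching of size $n$. -/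

import Mathlib

open MeasureTheory
open scoped InnerProductSpace

noncomputable section

/-- A polytope: a nonempty bounded subset of `ℝ^d` that is the solution set of finitely many
linear inequalities `⟪a, x⟫ ≤ b`. -/
def IsPolytope {d : ℕ} (P : Set (EuclideanSpace ℝ (Fin d))) : Prop :=
  P.Nonempty ∧ Bornology.IsBounded P ∧
    ∃ s : Finset (EuclideanSpace ℝ (Fin d) × ℝ), P = {x | ∀ p ∈ s, ⟪p.1, x⟫_ℝ ≤ p.2}

/-- The support function `h_P(u) = max_{x ∈ P} ⟪u, x⟫`. -/
def supportFun {d : ℕ} (P : Set (EuclideanSpace ℝ (Fin d))) (u : EuclideanSpace ℝ (Fin d)) : ℝ :=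
  sSup ((fun x => ⟪u, x⟫_ℝ) '' P)

/-- The normal cone `N_F(P)`: all `x` such that `⟪x, ·⟫` attains its maximum over `P` at every
point of `F`. -/
def normalCone {d : ℕ} (P F : Set (EuclideanSpace ℝ (Fin d))) :
    PointedCone ℝ (EuclideanSpace ℝ (Fin d)) where
  carrier := {x | ∀ p ∈ F, ∀ y ∈ P, ⟪x, y⟫_ℝ ≤ ⟪x, p⟫_ℝ}
  add_mem' := by
    intro a b ha hb p hp y hy
    rw [inner_add_left, inner_add_left]
    exact add_le_add (ha p hp y hy) (hb p hp y hy)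
  zero_mem' := by
    intro p _ y _
    simp
  smul_mem' := by
    intro c x hx p hp y hy
    have h1 : ⟪(c : ℝ) • x, y⟫_ℝ ≤ ⟪(c : ℝ) • x, p⟫_ℝ := by
      rw [real_inner_smul_left, real_inner_smul_left]
      exact mul_le_mul_of_nonneg_left (hx p hp y hy) c.2
    exact h1

/-- The normal fan `𝒩(P)`: the set of normal cones of all nonempty faces of `P`. The nonempty faces
are the nonempty exposed subsets, i.e. the sets of maximizers over `P` of linear functionals
(`P` itself arises from the zero functional). -/
def normalFan {d : ℕ} (P : Set (EuclideanSpace ℝ (Fin d))) :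
    Set (PointedCone ℝ (EuclideanSpace ℝ (Fin d))) :=
  {N | ∃ F : Set (EuclideanSpace ℝ (Fin d)), F.Nonempty ∧ IsExposed ℝ P F ∧ N = normalCone P F}

/-- A simplicial polytopal fan: the normal fan of a polytope, all of whose cones are generated by
linearly independent vectors. -/
def IsSimplicialPolytopalFan {d : ℕ} (Δ : Set (PointedCone ℝ (EuclideanSpace ℝ (Fin d)))) : Prop :=
  (∃ P, IsPolytope P ∧ Δ = normalFan P) ∧ ∀ σ ∈ Δ, σ.IsSimplicial

/-- `v 1, …, v n` are the ray generators of `Δ`: the map `i ↦ pos {v i}` is a bijection onto the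
set of one-dimensional cones of `Δ` (in particular `v i ≠ 0`, as `pos {0}` has dimension `0`). -/
def IsRayGenerators {d n : ℕ} (Δ : Set (PointedCone ℝ (EuclideanSpace ℝ (Fin d))))
    (v : Fin n → EuclideanSpace ℝ (Fin d)) : Prop :=
  Set.BijOn (fun i => PointedCone.hull ℝ {v i}) Set.univ
    {σ | σ ∈ Δ ∧ Module.finrank ℝ (Submodule.span ℝ (σ : Set (EuclideanSpace ℝ (Fin d)))) = 1}

/-- The deformation cone `𝒫(Δ)`: all polytopes `Q` whose normal fan is a coarsening of `Δ`, i.e.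
every cone of `𝒩(Q)` is a union of cones of `Δ`. -/
def deformationCone {d : ℕ} (Δ : Set (PointedCone ℝ (EuclideanSpace ℝ (Fin d)))) :
    Set (Set (EuclideanSpace ℝ (Fin d))) :=
  {Q | IsPolytope Q ∧ ∀ τ ∈ normalFan Q, ∃ S ⊆ Δ,
    (τ : Set (EuclideanSpace ℝ (Fin d))) = ⋃ σ ∈ S, (σ : Set (EuclideanSpace ℝ (Fin d)))}

/-- The least-squares loss `(1/m) ∑ i, (h_P(u⁽ⁱ⁾) - y⁽ⁱ⁾)²`. A matrix of directions
`U ∈ ℝ^{m × d}` is given by its rows `u⁽¹⁾, …, u⁽ᵐ⁾`. -/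
def lsLoss {d m : ℕ} (U : Fin m → EuclideanSpace ℝ (Fin d)) (y : Fin m → ℝ)
    (P : Set (EuclideanSpace ℝ (Fin d))) : ℝ :=
  (1 / (m : ℝ)) * ∑ i, (supportFun P (U i) - y i) ^ 2

/-- The least-squares estimator (solution set) `P̂^Δ(U, y)`: the set of all minimizers of the loss
over the deformation cone of `Δ`. -/
def lsEstimator {d m : ℕ} (Δ : Set (PointedCone ℝ (EuclideanSpace ℝ (Fin d))))
    (U : Fin m → EuclideanSpace ℝ (Fin d)) (y : Fin m → ℝ) :
    Set (Set (EuclideanSpace ℝ (Fin d))) :=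
  {P | P ∈ deformationCone Δ ∧ ∀ Q ∈ deformationCone Δ, lsLoss U y P ≤ lsLoss U y Q}

/-- The set `𝒰` of all `U ∈ ℝ^{m × d}` such that `|P̂^Δ(U, y)| = 1` for all `y ∈ ℝ^m`. -/
def uniqueDirections {d : ℕ} (m : ℕ) (Δ : Set (PointedCone ℝ (EuclideanSpace ℝ (Fin d)))) :
    Set (Fin m → EuclideanSpace ℝ (Fin d)) :=
  {U | ∀ y : Fin m → ℝ, (lsEstimator Δ U y).encard = 1}

/-- `c` is the vector `[u]^Δ`: for the cone `σ = pos {v i | i ∈ I} ∈ Δ` with `u ∈ relint σ`, one has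
`u = ∑ i ∈ I, c i • v i` and `c i = 0` for `i ∉ I`. -/
def IsRayCoords {d n : ℕ} (Δ : Set (PointedCone ℝ (EuclideanSpace ℝ (Fin d))))
    (v : Fin n → EuclideanSpace ℝ (Fin d)) (u : EuclideanSpace ℝ (Fin d)) (c : Fin n → ℝ) : Prop :=
  ∃ σ ∈ Δ, u ∈ intrinsicInterior ℝ (σ : Set (EuclideanSpace ℝ (Fin d))) ∧
    ∃ I : Finset (Fin n), σ = PointedCone.hull ℝ (v '' (I : Set (Fin n))) ∧
      u = ∑ i ∈ I, c i • v i ∧ ∀ i, i ∉ I → c i = 0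

/-- The vector `[u]^Δ ∈ ℝ^n`. It is uniquely characterized by `IsRayCoords` when `Δ` is a simplicial
polytopal fan with ray generators `v`. -/
def rayCoords {d n : ℕ} (Δ : Set (PointedCone ℝ (EuclideanSpace ℝ (Fin d))))
    (v : Fin n → EuclideanSpace ℝ (Fin d)) (u : EuclideanSpace ℝ (Fin d)) : Fin n → ℝ :=
  Classical.epsilon fun c => IsRayCoords Δ v u c

/-- The bipartite graph `G_U` on `[n] ⊔ [m]`, where `i ∈ [n]` and `j ∈ [m]` are joined if and only
if `[u⁽ʲ⁾]_i > 0`. -/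
def directionGraph {d n m : ℕ} (Δ : Set (PointedCone ℝ (EuclideanSpace ℝ (Fin d))))
    (v : Fin n → EuclideanSpace ℝ (Fin d)) (U : Fin m → EuclideanSpace ℝ (Fin d)) :
    SimpleGraph (Fin n ⊕ Fin m) where
  Adj a b :=
    (∃ i j, a = Sum.inl i ∧ b = Sum.inr j ∧ 0 < rayCoords Δ v (U j) i) ∨
    (∃ i j, a = Sum.inr j ∧ b = Sum.inl i ∧ 0 < rayCoords Δ v (U j) i)
  symm := ⟨by
    rintro a b (⟨i, j, h1, h2, h3⟩ | ⟨i, j, h1, h2, h3⟩)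
    · exact Or.inr ⟨i, j, h2, h1, h3⟩
    · exact Or.inl ⟨i, j, h2, h1, h3⟩⟩
  loopless := ⟨by
    rintro a (⟨i, j, h1, h2, -⟩ | ⟨i, j, h1, h2, -⟩) <;> simp_all⟩

/-- The graph `G` has a matching with exactly `k` edges. -/
def HasMatchingOfSize {V : Type*} (G : SimpleGraph V) (k : ℕ) : Prop :=
  ∃ M : G.Subgraph, M.IsMatching ∧ M.edgeSet.encard = k

end

/-! ### Polytopes, exposed faces and normal cones. -/

section Polytope

variable {d : ℕ} {P Q F F' : Set (EuclideanSpace ℝ (Fin d))}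

/-! On the deformation cone, support functions are linear on every cone of `Δ`, so `h_Q(u) = ∑ i,
[u]_i * h_Q(v i)` (`supportFun_eq_sum_rayCoords`), and `Q` is determined by the numbers `h_Q(v i)`.
The vectors that arise in this way form a closed convex set `supportVectors`, which is a
neighbourhood of the vector of the polytope defining `Δ` because `Δ` is simplicial
(`supportVectors_mem_nhds`). Least squares thus becomes minimising `‖A h - y‖²` over this set, where
`A` has rows `[u⁽ʲ⁾]`. An injective `A` gives exactly one minimiser. A nonzero kernel vector gives
two minimisers when `y = A h₀` with `h₀` interior. Hence `U ∈ 𝒰` iff `A` is injective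
(`mem_uniqueDirections_iff`).

Since `u ↦ [u]` is continuous and `[v i]` is the `i`-th unit vector, an `n × n` minor of `A` is
nonzero near any `U` having all `v i` among its rows; this gives the interior. For the matching
criterion, injectivity yields Hall's condition on the support of `A`, whose entries are nonnegative.
Conversely, a matching selects a minor of `A`. Once the cones containing the rows are fixed, this
minor is a polynomial in `U`, and it is monic in `t` along a suitable line, so it vanishes only on a
null set (`ae_det_coneCoordMatrix_ne_zero`). Only finitely many cones and matchings occur. -/

theorem IsPolytope.convex (hP : IsPolytope P) : Convex ℝ P := by
  obtain ⟨-, -, s, rfl⟩ := hP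
  intro x hx y hy a b ha hb hab p hp
  have h1 := mul_le_mul_of_nonneg_left (hx p hp) ha
  have h2 := mul_le_mul_of_nonneg_left (hy p hp) hb
  have h3 : a * p.2 + b * p.2 = p.2 := by rw [← add_mul, hab, one_mul]
  rw [inner_add_right, real_inner_smul_right, real_inner_smul_right]
  linarith

theorem IsPolytope.isClosed (hP : IsPolytope P) : IsClosed P := by
  obtain ⟨-, -, s, rfl⟩ := hP
  simp only [Set.ofPred_forall]
  exact isClosed_biInter fun p _ => isClosed_le (by fun_prop) continuous_const

theorem IsPolytope.isCompact (hP : IsPolytope P) : IsCompact P :=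
  Metric.isCompact_of_isClosed_isBounded hP.isClosed hP.2.1

/-- The face of `P` on which the functional `⟪u, ·⟫` is maximal. -/
def exposedFace (P : Set (EuclideanSpace ℝ (Fin d))) (u : EuclideanSpace ℝ (Fin d)) :
    Set (EuclideanSpace ℝ (Fin d)) :=
  {x ∈ P | ∀ y ∈ P, ⟪u, y⟫_ℝ ≤ ⟪u, x⟫_ℝ}

theorem IsPolytope.exposedFace_nonempty (hP : IsPolytope P) (u : EuclideanSpace ℝ (Fin d)) :
    (exposedFace P u).Nonempty := by
  obtain ⟨x, hx, hmax⟩ := hP.isCompact.exists_isMaxOn hP.1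
    (f := fun x => ⟪u, x⟫_ℝ) (by fun_prop)
  exact ⟨x, hx, fun y hy => hmax hy⟩

theorem supportFun_eq_of_mem_exposedFace {u x : EuclideanSpace ℝ (Fin d)}
    (hx : x ∈ exposedFace P u) : supportFun P u = ⟪u, x⟫_ℝ :=
  IsGreatest.csSup_eq ⟨⟨x, hx.1, rfl⟩, by rintro _ ⟨y, hy, rfl⟩; exact hx.2 y hy⟩

theorem IsPolytope.inner_le_supportFun (hP : IsPolytope P) (u : EuclideanSpace ℝ (Fin d))
    {x : EuclideanSpace ℝ (Fin d)} (hx : x ∈ P) : ⟪u, x⟫_ℝ ≤ supportFun P u := by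
  obtain ⟨p, hp⟩ := hP.exposedFace_nonempty u
  rw [supportFun_eq_of_mem_exposedFace hp]
  exact hp.2 x hx

/-- No separation theorem is needed: a defining inequality `⟪a, ·⟫ ≤ b` of `P` satisfies `h_P(a) ≤
b`. -/
theorem IsPolytope.mem_iff (hP : IsPolytope P) (x : EuclideanSpace ℝ (Fin d)) :
    x ∈ P ↔ ∀ u, ⟪u, x⟫_ℝ ≤ supportFun P u := by
  refine ⟨fun hx u => hP.inner_le_supportFun u hx, fun h => ?_⟩
  have hP' := hP
  obtain ⟨-, -, s, hs⟩ := hP'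
  have hmem : ∀ y, y ∈ P ↔ ∀ p ∈ s, ⟪p.1, y⟫_ℝ ≤ p.2 := fun y => by rw [hs]; rfl
  refine (hmem x).2 fun p hp => (h p.1).trans ?_
  obtain ⟨q, hq⟩ := hP.exposedFace_nonempty p.1
  rw [supportFun_eq_of_mem_exposedFace hq]
  exact (hmem q).1 hq.1 p hp

theorem mem_exposedFace_iff (hP : IsPolytope P) {u x : EuclideanSpace ℝ (Fin d)} :
    x ∈ exposedFace P u ↔ x ∈ P ∧ ⟪u, x⟫_ℝ = supportFun P u := by
  refine ⟨fun h => ⟨h.1, (supportFun_eq_of_mem_exposedFace h).symm⟩, fun h => ⟨h.1, fun y hy => ?_⟩⟩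
  rw [h.2]
  exact hP.inner_le_supportFun u hy

/-- An extreme point is determined by its set of tight inequalities, and there are finitely many
such sets. -/
theorem IsPolytope.finite_extremePoints (hP : IsPolytope P) : (P.extremePoints ℝ).Finite := by
  classical
  obtain ⟨-, -, s, rfl⟩ := hP
  refine Set.Finite.of_finite_image (f := fun x => s.filter fun p => ⟪p.1, x⟫_ℝ = p.2)
    ((s.powerset.finite_toSet).subset ?_) ?_
  · rintro _ ⟨x, -, rfl⟩
    exact Finset.mem_coe.2 (Finset.mem_powerset.2 (Finset.filter_subset _ _))
  · intro x hx y hy hxy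
    beta_reduce at hxy
    by_contra hne
    -- Inequalities tight at both points stay tight on their line; those slack at `x` survive small
    -- `t`. So `x` is the midpoint of two points of the polytope.
    have key : ∀ᶠ t in nhds (0 : ℝ), ∀ p ∈ s, ⟪p.1, x + t • (y - x)⟫_ℝ ≤ p.2 := by
      rw [Filter.eventually_all_finset]
      intro p hp
      by_cases hpx : ⟪p.1, x⟫_ℝ = p.2
      · have hpy : p ∈ s.filter fun p => ⟪p.1, y⟫_ℝ = p.2 := by
          have : p ∈ s.filter fun p => ⟪p.1, x⟫_ℝ = p.2 := by simp [hp, hpx]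
          rwa [hxy] at this
        rw [Finset.mem_filter] at hpy
        refine Filter.Eventually.of_forall fun t => ?_
        rw [inner_add_right, real_inner_smul_right, inner_sub_right, hpx, hpy.2]
        simp
      · have hlt : ⟪p.1, x⟫_ℝ < p.2 := lt_of_le_of_ne (hx.1 p hp) hpx
        have hc : Continuous fun t : ℝ => ⟪p.1, x + t • (y - x)⟫_ℝ := by fun_prop
        have h0 : ⟪p.1, x + (0 : ℝ) • (y - x)⟫_ℝ < p.2 := by simpa using hlt
        filter_upwards [hc.continuousAt.eventually_lt_const h0] with t ht using ht.le
    have key' : ∀ᶠ t in nhds (0 : ℝ), ∀ p ∈ s, ⟪p.1, x + (-t) • (y - x)⟫_ℝ ≤ p.2 := by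
      have : Filter.Tendsto (fun t : ℝ => -t) (nhds 0) (nhds 0) := by
        simpa using (continuous_neg (G := ℝ)).tendsto 0
      exact this.eventually key
    obtain ⟨t, ⟨h1, h2⟩, ht⟩ := (((key.and key').filter_mono nhdsWithin_le_nhds).and
      (self_mem_nhdsWithin : Set.Ioi (0 : ℝ) ∈ nhdsWithin 0 (Set.Ioi 0))).exists
    have h3 : x ∈ openSegment ℝ (x + t • (y - x)) (x + (-t) • (y - x)) := by
      refine ⟨1 / 2, 1 / 2, by norm_num, by norm_num, by norm_num, ?_⟩
      module
    have h4 := hx.2 h1 h2 h3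
    have h5 : t • (y - x) = 0 := by simpa using h4
    rcases smul_eq_zero.1 h5 with h | h
    · exact (ne_of_gt ht) h
    · exact hne (sub_eq_zero.1 h).symm

theorem normalCone_anti (h : F ⊆ F') : normalCone P F' ≤ normalCone P F :=
  fun _ hx _ hp => hx _ (h hp)

theorem mem_normalCone {x : EuclideanSpace ℝ (Fin d)} :
    x ∈ normalCone P F ↔ ∀ p ∈ F, ∀ y ∈ P, ⟪x, y⟫_ℝ ≤ ⟪x, p⟫_ℝ := Iff.rfl

theorem mem_normalCone_exposedFace (u : EuclideanSpace ℝ (Fin d)) :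
    u ∈ normalCone P (exposedFace P u) := fun _ hp => hp.2

theorem mem_normalCone_iff_subset {u : EuclideanSpace ℝ (Fin d)} (hF : F ⊆ P) :
    u ∈ normalCone P F ↔ F ⊆ exposedFace P u :=
  ⟨fun h p hp => ⟨hF hp, h p hp⟩, fun h _ hp => (h hp).2⟩

theorem isClosed_normalCone (P F : Set (EuclideanSpace ℝ (Fin d))) :
    IsClosed (normalCone P F : Set (EuclideanSpace ℝ (Fin d))) := by
  have : (normalCone P F : Set (EuclideanSpace ℝ (Fin d))) =
      ⋂ p ∈ F, ⋂ y ∈ P, {x | ⟪x, y⟫_ℝ ≤ ⟪x, p⟫_ℝ} := by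
    ext x
    simp [mem_normalCone]
  rw [this]
  exact isClosed_biInter fun _ _ => isClosed_biInter fun _ _ =>
    isClosed_le (by fun_prop) (by fun_prop)

theorem isExposed_exposedFace (u : EuclideanSpace ℝ (Fin d)) : IsExposed ℝ P (exposedFace P u) :=
  fun _ => ⟨innerSL ℝ u, rfl⟩

theorem mem_normalFan_iff (hP : IsPolytope P) {σ : PointedCone ℝ (EuclideanSpace ℝ (Fin d))} :
    σ ∈ normalFan P ↔ ∃ u, σ = normalCone P (exposedFace P u) := by
  constructor
  · rintro ⟨F, hF, hexp, rfl⟩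
    obtain ⟨l, rfl⟩ := hexp hF
    refine ⟨(InnerProductSpace.toDual ℝ _).symm l, ?_⟩
    simp [exposedFace]
  · rintro ⟨u, rfl⟩
    exact ⟨_, hP.exposedFace_nonempty u, isExposed_exposedFace u, rfl⟩

/-- Normal cones of larger faces are extreme subcones. -/
theorem left_mem_normalCone_of_add_mem {a b : EuclideanSpace ℝ (Fin d)} (hF : F.Nonempty)
    (hFF' : F ⊆ F') (hF' : F' ⊆ P) (ha : a ∈ normalCone P F) (hb : b ∈ normalCone P F)
    (hab : a + b ∈ normalCone P F') : a ∈ normalCone P F' := by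
  -- The inequalities for `b` at `p` versus `f` and for `a + b` at `f` versus `p` combine to `⟪a, f⟫
  -- ≤ ⟪a, p⟫`.
  obtain ⟨f, hf⟩ := hF
  intro p hp y hy
  have h1 := ha f hf y hy
  have h2 := hb f hf p (hF' hp)
  have h3 := hab p hp f (hF' (hFF' hf))
  rw [inner_add_left, inner_add_left] at h3
  linarith

/-- A functional lies in the relative interior of the normal cone of the face it exposes. -/
theorem IsPolytope.exists_sub_smul_mem_normalCone (hP : IsPolytope P)
    {u z : EuclideanSpace ℝ (Fin d)} (hz : z ∈ normalCone P (exposedFace P u)) :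
    ∃ ε : ℝ, 0 < ε ∧ u - ε • z ∈ normalCone P (exposedFace P u) := by
  obtain ⟨f, hf⟩ := hP.exposedFace_nonempty u
  -- On the face both `u` and `z` are constant; at each of the finitely many extreme points off the
  -- face there is a strict gap in `u`, which a small `ε` cannot close.
  have key : ∀ᶠ ε in nhdsWithin (0 : ℝ) (Set.Ioi 0), ∀ p ∈ P.extremePoints ℝ,
      ⟪u - ε • z, p⟫_ℝ ≤ ⟪u - ε • z, f⟫_ℝ := by
    rw [Filter.eventually_all_finite hP.finite_extremePoints]
    intro p hp
    by_cases hpF : p ∈ exposedFace P u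
    · refine Filter.Eventually.of_forall fun ε => ?_
      have h1 := le_antisymm (hpF.2 f hf.1) (hf.2 p hpF.1)
      have h2 := le_antisymm (hz p hpF f hf.1) (hz f hf p hpF.1)
      rw [inner_sub_left, inner_sub_left, real_inner_smul_left, real_inner_smul_left, h1, h2]
    · have hlt : ⟪u, p⟫_ℝ < ⟪u, f⟫_ℝ := by
        refine lt_of_le_of_ne (hf.2 p hp.1) fun h => hpF ⟨hp.1, fun y hy => ?_⟩
        rw [h]
        exact hf.2 y hy
      have hc : Continuous fun ε : ℝ => ⟪u - ε • z, f⟫_ℝ - ⟪u - ε • z, p⟫_ℝ := by fun_prop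
      have h0 : 0 < ⟪u - (0 : ℝ) • z, f⟫_ℝ - ⟪u - (0 : ℝ) • z, p⟫_ℝ := by simpa using hlt
      filter_upwards [(hc.continuousAt.eventually_const_lt h0).filter_mono nhdsWithin_le_nhds]
        with ε hε
      linarith
  obtain ⟨ε, hε, hε0⟩ := (key.and self_mem_nhdsWithin).exists
  refine ⟨ε, hε0, ?_⟩
  -- Krein–Milman carries the inequality from the extreme points to `P`.
  have hP' : ∀ y ∈ P, ⟪u - ε • z, y⟫_ℝ ≤ ⟪u - ε • z, f⟫_ℝ := by
    have hcl : IsClosed {y | ⟪u - ε • z, y⟫_ℝ ≤ ⟪u - ε • z, f⟫_ℝ} :=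
      isClosed_le (by fun_prop) continuous_const
    have hcv : Convex ℝ {y | ⟪u - ε • z, y⟫_ℝ ≤ ⟪u - ε • z, f⟫_ℝ} :=
      convex_halfSpace_le (innerSL ℝ (u - ε • z)).isLinear _
    have hsub : P ⊆ {y | ⟪u - ε • z, y⟫_ℝ ≤ ⟪u - ε • z, f⟫_ℝ} := by
      conv_lhs => rw [← closure_convexHull_extremePoints hP.isCompact hP.convex]
      exact closure_minimal (convexHull_min hε hcv) hcl
    exact hsub
  intro p hpF y hy
  have h1 := le_antisymm (hpF.2 f hf.1) (hf.2 p hpF.1)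
  have h2 := le_antisymm (hz p hpF f hf.1) (hz f hf p hpF.1)
  have h3 := hP' y hy
  rw [inner_sub_left, real_inner_smul_left] at h3 ⊢
  rw [inner_sub_left, real_inner_smul_left] at h3 ⊢
  rw [← h1, ← h2]
  exact h3

end Polytope

/-! ### Finitely generated cones and their coefficients. -/

section ConicHull

variable {V ι : Type*} [AddCommGroup V] [Module ℝ V]

theorem mem_hull_range_iff [Fintype ι] {w : ι → V} {x : V} :
    x ∈ PointedCone.hull ℝ (Set.range w) ↔ ∃ c : ι → ℝ, (∀ i, 0 ≤ c i) ∧ x = ∑ i, c i • w i := by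
  rw [PointedCone.hull, Submodule.mem_span_range_iff_exists_fun]
  constructor
  · rintro ⟨c, rfl⟩
    exact ⟨fun i => c i, fun i => (c i).2, rfl⟩
  · rintro ⟨c, hc, rfl⟩
    exact ⟨fun i => ⟨c i, hc i⟩, rfl⟩

theorem mem_hull_singleton_iff {w x : V} :
    x ∈ PointedCone.hull ℝ {w} ↔ ∃ c : ℝ, 0 ≤ c ∧ x = c • w := by
  rw [PointedCone.hull, Submodule.mem_span_singleton]
  constructor
  · rintro ⟨c, rfl⟩
    exact ⟨c, c.2, rfl⟩
  · rintro ⟨c, hc, rfl⟩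
    exact ⟨⟨c, hc⟩, rfl⟩

theorem mem_hull_image_iff [Fintype ι] {w : ι → V} {I : Finset ι} {x : V} :
    x ∈ PointedCone.hull ℝ (w '' (I : Set ι)) ↔
      ∃ c : ι → ℝ, (∀ i, 0 ≤ c i) ∧ (∀ i, i ∉ I → c i = 0) ∧ x = ∑ i, c i • w i := by
  classical
  constructor
  · intro hx
    rw [PointedCone.hull, Submodule.mem_span_image_finset_iff_exists_fun] at hx
    obtain ⟨c, rfl⟩ := hx
    refine ⟨fun i => if h : i ∈ I then c ⟨i, h⟩ else 0, fun i => ?_, fun i hi => by simp [hi], ?_⟩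
    · beta_reduce
      split_ifs with h
      · exact (c ⟨i, h⟩).2
      · exact le_rfl
    · rw [← Finset.sum_subset (Finset.subset_univ I) (fun i _ hi => by simp [hi]),
        ← Finset.sum_coe_sort I]
      refine Finset.sum_congr rfl fun i _ => ?_
      beta_reduce
      rw [dif_pos i.2]
      rfl
  · rintro ⟨c, hc, hc0, rfl⟩
    refine Submodule.sum_mem _ fun i _ => ?_
    by_cases hi : i ∈ I
    · exact PointedCone.smul_mem _ (hc i) (Submodule.subset_span ⟨i, hi, rfl⟩)
    · rw [hc0 i hi, zero_smul]
      exact Submodule.zero_mem _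

theorem LinearIndependent.eq_of_sum_smul_eq [Fintype ι] {w : ι → V} (hw : LinearIndependent ℝ w)
    {a b : ι → ℝ} (h : ∑ i, a i • w i = ∑ i, b i • w i) : a = b := by
  funext i
  have := Fintype.linearIndependent_iff.1 hw (a - b) (by simp [sub_smul, h]) i
  simpa [sub_eq_zero] using this

theorem LinearIndepOn.eq_of_sum_smul_eq [Fintype ι] {w : ι → V} {I : Finset ι}
    (hw : LinearIndepOn ℝ w (I : Set ι)) {a b : ι → ℝ} (ha : ∀ i, i ∉ I → a i = 0)
    (hb : ∀ i, i ∉ I → b i = 0) (h : ∑ i, a i • w i = ∑ i, b i • w i) : a = b := by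
  funext i
  by_cases hi : i ∈ I
  · have := linearIndepOn_finset_iff.1 hw (a - b) (by
      rw [Finset.sum_subset (Finset.subset_univ I) (fun i _ hi => by simp [ha i hi, hb i hi])]
      simp [sub_smul, h]) i hi
    simpa [sub_eq_zero] using this
  · rw [ha i hi, hb i hi]

theorem PointedCone.IsSimplicial.exists_range {σ : PointedCone ℝ V} (hσ : σ.IsSimplicial) :
    ∃ (k : ℕ) (w : Fin k → V), LinearIndependent ℝ w ∧ σ = PointedCone.hull ℝ (Set.range w) := by
  obtain ⟨s, hs, hli, rfl⟩ := hσ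
  have := hs.fintype
  let e := (Fintype.equivFin s).symm
  refine ⟨Fintype.card s, fun i => (e i : V), ?_, ?_⟩
  · exact LinearIndependent.comp hli e e.injective
  · congr 1
    ext x
    constructor
    · exact fun hx => ⟨e.symm ⟨x, hx⟩, by simp⟩
    · rintro ⟨i, rfl⟩
      exact (e i).2

end ConicHull

/-! ### Simplicial fans, their ray generators and the ray coordinates. -/

section Fan

variable {d n : ℕ} {Δ : Set (PointedCone ℝ (EuclideanSpace ℝ (Fin d)))}
  {v : Fin n → EuclideanSpace ℝ (Fin d)}

theorem IsSimplicialPolytopalFan.isClosed (hΔ : IsSimplicialPolytopalFan Δ)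
    {σ : PointedCone ℝ (EuclideanSpace ℝ (Fin d))} (hσ : σ ∈ Δ) :
    IsClosed (σ : Set (EuclideanSpace ℝ (Fin d))) := by
  obtain ⟨⟨P, -, rfl⟩, -⟩ := hΔ
  obtain ⟨F, -, -, rfl⟩ := hσ
  exact isClosed_normalCone P F

/-- A generator of a simplicial cone of the fan spans a ray of the fan. -/
theorem IsSimplicialPolytopalFan.hull_singleton_mem (hΔ : IsSimplicialPolytopalFan Δ)
    {ι : Type*} [Fintype ι] {w : ι → EuclideanSpace ℝ (Fin d)} (hw : LinearIndependent ℝ w)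
    (hσ : PointedCone.hull ℝ (Set.range w) ∈ Δ) (k : ι) : PointedCone.hull ℝ {w k} ∈ Δ := by
  classical
  obtain ⟨⟨P, hP, rfl⟩, -⟩ := hΔ
  have hwk : w k ∈ PointedCone.hull ℝ (Set.range w) := Submodule.subset_span ⟨k, rfl⟩
  obtain ⟨u₀, hu₀⟩ := (mem_normalFan_iff hP).1 hσ
  have hne := hP.exposedFace_nonempty u₀
  have hsub : exposedFace P u₀ ⊆ P := fun x hx => hx.1
  have hsub' : exposedFace P (w k) ⊆ P := fun x hx => hx.1
  have hFF : exposedFace P u₀ ⊆ exposedFace P (w k) :=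
    (mem_normalCone_iff_subset hsub).1 (hu₀ ▸ hwk)
  refine (mem_normalFan_iff hP).2 ⟨w k, le_antisymm ?_ ?_⟩
  · rw [PointedCone.hull, Submodule.span_singleton_le_iff_mem]
    exact mem_normalCone_exposedFace _
  · intro x hx
    obtain ⟨c, hc, rfl⟩ := mem_hull_range_iff.1 (hu₀ ▸ normalCone_anti hFF hx)
    -- If `c j > 0`, extremality puts `w j` into the normal cone of the face exposed by `w k`. As `w
    -- k` is relatively interior there, `w k - ε • w j` stays in the simplicial cone, although its
    -- `j`-th coefficient is `-ε`.
    have hzero : ∀ j, j ≠ k → c j = 0 := by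
      intro j hj
      by_contra hcj
      have hcj' : 0 < c j := lt_of_le_of_ne (hc j) (Ne.symm hcj)
      rw [← Finset.add_sum_erase _ _ (Finset.mem_univ j)] at hx
      have hj1 : c j • w j ∈ normalCone P (exposedFace P (w k)) := by
        refine left_mem_normalCone_of_add_mem hne hFF hsub' ?_ ?_ hx
        · rw [← hu₀]
          exact PointedCone.smul_mem _ (hc j) (Submodule.subset_span ⟨j, rfl⟩)
        · rw [← hu₀]
          exact Submodule.sum_mem _ fun i _ =>
            PointedCone.smul_mem _ (hc i) (Submodule.subset_span ⟨i, rfl⟩)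
      rw [PointedCone.smul_mem_iff _ hcj'] at hj1
      obtain ⟨ε, hε, hmem⟩ := hP.exists_sub_smul_mem_normalCone hj1
      obtain ⟨e, he, hsum⟩ := mem_hull_range_iff.1 (hu₀ ▸ normalCone_anti hFF hmem)
      have hab : ∑ i, (Pi.single k 1 - ε • Pi.single j 1 : ι → ℝ) i • w i = ∑ i, e i • w i := by
        rw [← hsum]
        simp [sub_smul, Pi.single_apply, Finset.sum_sub_distrib]
      have := congrFun (hw.eq_of_sum_smul_eq hab) j
      simp [hj] at this
      linarith [he j]
    rw [Finset.sum_eq_single k (fun j _ hj => by rw [hzero j hj, zero_smul]) (by simp)]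
    exact PointedCone.smul_mem _ (hc k) (Submodule.subset_span rfl)

/-- A positive combination lying in a cone of the fan has all its terms in that cone, provided
that the combined vectors lie in a common cone of the fan. -/
theorem IsSimplicialPolytopalFan.mem_of_sum_mem (hΔ : IsSimplicialPolytopalFan Δ)
    {ι : Type*} [Fintype ι] {w : ι → EuclideanSpace ℝ (Fin d)}
    {σ τ : PointedCone ℝ (EuclideanSpace ℝ (Fin d))} (hσ : σ ∈ Δ) (hτ : τ ∈ Δ) {c : ι → ℝ}
    (hc : ∀ i, 0 ≤ c i) (hw : ∀ i, 0 < c i → w i ∈ σ) (hsum : ∑ i, c i • w i ∈ τ) {k : ι}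
    (hk : 0 < c k) : w k ∈ τ := by
  classical
  obtain ⟨⟨P, hP, rfl⟩, -⟩ := hΔ
  obtain ⟨u₀, rfl⟩ := (mem_normalFan_iff hP).1 hσ
  obtain ⟨u₁, rfl⟩ := (mem_normalFan_iff hP).1 hτ
  have hsub : ∀ u, exposedFace P u ⊆ P := fun u x hx => hx.1
  have hmem : ∀ i, c i • w i ∈ normalCone P (exposedFace P u₀) := by
    intro i
    rcases (hc i).eq_or_lt with h | h
    · rw [← h, zero_smul]
      exact Submodule.zero_mem _
    · exact PointedCone.smul_mem _ h.le (hw i h)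
  set u := ∑ i, c i • w i with hu
  have hu0 : u ∈ normalCone P (exposedFace P u₀) := Submodule.sum_mem _ fun i _ => hmem i
  have h0 := (mem_normalCone_iff_subset (hsub _)).1 hu0
  have h1 := (mem_normalCone_iff_subset (hsub _)).1 hsum
  -- Both exposed faces lie in the one exposed by `u`, so its normal cone is contained in `τ` and
  -- extreme in `σ`.
  refine normalCone_anti h1 ?_
  rw [← PointedCone.smul_mem_iff _ hk]
  have huE := mem_normalCone_exposedFace (P := P) u
  have hu' : u = c k • w k + ∑ i ∈ Finset.univ.erase k, c i • w i :=
    (Finset.add_sum_erase _ (fun i => c i • w i) (Finset.mem_univ k)).symm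
  refine left_mem_normalCone_of_add_mem (hP.exposedFace_nonempty u₀) h0 (hsub _) (hmem k)
    (Submodule.sum_mem _ fun i _ => hmem i) (b := ∑ i ∈ Finset.univ.erase k, c i • w i) ?_
  rw [← hu']
  exact huE

theorem IsRayGenerators.hull_mem (hv : IsRayGenerators Δ v) (i : Fin n) :
    PointedCone.hull ℝ {v i} ∈ Δ := (hv.1 (Set.mem_univ i)).1

theorem IsRayGenerators.ne_zero (hv : IsRayGenerators Δ v) (i : Fin n) : v i ≠ 0 := by
  intro h
  have h1 := (hv.1 (Set.mem_univ i)).2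
  have h2 : Submodule.span ℝ
      ((PointedCone.hull ℝ {v i} : PointedCone ℝ _) : Set (EuclideanSpace ℝ (Fin d))) = ⊥ := by
    rw [Submodule.span_eq_bot]
    intro x hx
    obtain ⟨c, -, rfl⟩ := mem_hull_singleton_iff.1 hx
    rw [h, smul_zero]
  beta_reduce at h1
  rw [h2, finrank_bot] at h1
  exact zero_ne_one h1

theorem hull_singleton_eq_of_eq_smul {V : Type*} [AddCommGroup V] [Module ℝ V] {x y : V} {c : ℝ}
    (hc : 0 < c) (h : x = c • y) : PointedCone.hull ℝ {x} = PointedCone.hull ℝ {y} := by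
  have hy : y = c⁻¹ • x := by rw [h, smul_smul, inv_mul_cancel₀ hc.ne', one_smul]
  refine le_antisymm ?_ ?_
  · rw [PointedCone.hull, Submodule.span_singleton_le_iff_mem]
    exact mem_hull_singleton_iff.2 ⟨c, hc.le, h⟩
  · rw [PointedCone.hull, Submodule.span_singleton_le_iff_mem]
    exact mem_hull_singleton_iff.2 ⟨c⁻¹, (inv_pos.2 hc).le, hy⟩

theorem IsRayGenerators.eq_of_eq_smul (hv : IsRayGenerators Δ v) {i j : Fin n} {c : ℝ}
    (hc : 0 < c) (h : v i = c • v j) : i = j :=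
  hv.2.1 (Set.mem_univ i) (Set.mem_univ j) (hull_singleton_eq_of_eq_smul hc h)

theorem IsRayGenerators.exists_eq_smul_of_linearIndependent (hΔ : IsSimplicialPolytopalFan Δ)
    (hv : IsRayGenerators Δ v) {ι : Type*} [Fintype ι] {w : ι → EuclideanSpace ℝ (Fin d)}
    (hw : LinearIndependent ℝ w) (hσ : PointedCone.hull ℝ (Set.range w) ∈ Δ) (k : ι) :
    ∃ i, ∃ c : ℝ, 0 < c ∧ w k = c • v i := by
  have hmem := hΔ.hull_singleton_mem hw hσ k
  have hspan : Submodule.span ℝ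
      ((PointedCone.hull ℝ {w k} : PointedCone ℝ _) : Set (EuclideanSpace ℝ (Fin d))) =
      Submodule.span ℝ {w k} := by
    refine le_antisymm (Submodule.span_le.2 fun x hx => ?_)
      (Submodule.span_mono Submodule.subset_span)
    obtain ⟨c, -, rfl⟩ := mem_hull_singleton_iff.1 hx
    exact Submodule.smul_mem _ _ (Submodule.mem_span_singleton_self _)
  obtain ⟨i, -, hi⟩ := hv.2.2 (show PointedCone.hull ℝ {w k} ∈ {σ | σ ∈ Δ ∧ _} from
    ⟨hmem, by rw [hspan, finrank_span_singleton (hw.ne_zero k)]⟩)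
  have hwk : w k ∈ PointedCone.hull ℝ {v i} := by
    have : w k ∈ PointedCone.hull ℝ {w k} := Submodule.subset_span rfl
    exact (show PointedCone.hull ℝ {v i} = PointedCone.hull ℝ {w k} from hi) ▸ this
  obtain ⟨c, hc, h⟩ := mem_hull_singleton_iff.1 hwk
  refine ⟨i, c, lt_of_le_of_ne hc fun h0 => hw.ne_zero k ?_, h⟩
  rw [h, ← h0, zero_smul]

/-- Write `v i` as a nonnegative combination of the `w k`; since `pos {v i}` is itself a cone of the
fan, every `w k` with a positive coefficient lies on that ray. -/
theorem IsRayGenerators.exists_generator_eq_smul (hΔ : IsSimplicialPolytopalFan Δ)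
    (hv : IsRayGenerators Δ v) {ι : Type*} [Fintype ι] {w : ι → EuclideanSpace ℝ (Fin d)}
    (hw : ∀ k, w k ≠ 0) (hσ : PointedCone.hull ℝ (Set.range w) ∈ Δ) {i : Fin n}
    (hi : v i ∈ PointedCone.hull ℝ (Set.range w)) : ∃ k, ∃ c : ℝ, 0 < c ∧ v i = c • w k := by
  obtain ⟨c, hc, hsum⟩ := mem_hull_range_iff.1 hi
  obtain ⟨k, hk⟩ : ∃ k, 0 < c k := by
    by_contra! h
    refine hv.ne_zero i ?_
    rw [hsum]
    exact Finset.sum_eq_zero fun k _ => by rw [le_antisymm (h k) (hc k), zero_smul]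
  have hwk : w k ∈ PointedCone.hull ℝ {v i} := by
    refine hΔ.mem_of_sum_mem hσ (hv.hull_mem i) hc
      (fun j _ => Submodule.subset_span ⟨j, rfl⟩) ?_ hk
    rw [← hsum]
    exact Submodule.subset_span rfl
  obtain ⟨a, ha, hka⟩ := mem_hull_singleton_iff.1 hwk
  have ha0 : 0 < a := lt_of_le_of_ne ha fun h0 => hw k (by rw [hka, ← h0, zero_smul])
  exact ⟨k, a⁻¹, inv_pos.2 ha0, by rw [hka, smul_smul, inv_mul_cancel₀ ha0.ne', one_smul]⟩

/-- Simpliciality supplies some independent generators; the `v i` are positive multiples of pairwise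
different ones among them. -/
theorem IsRayGenerators.linearIndepOn (hΔ : IsSimplicialPolytopalFan Δ)
    (hv : IsRayGenerators Δ v) {I : Finset (Fin n)}
    (hI : PointedCone.hull ℝ (v '' (I : Set (Fin n))) ∈ Δ) :
    LinearIndepOn ℝ v (I : Set (Fin n)) := by
  obtain ⟨k, w, hw, hσ⟩ := (hΔ.2 _ hI).exists_range
  have hex : ∀ i : (I : Set (Fin n)), ∃ k, ∃ c : ℝ, 0 < c ∧ v i = c • w k := fun i =>
    hv.exists_generator_eq_smul hΔ hw.ne_zero (hσ ▸ hI)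
      (hσ ▸ Submodule.subset_span ⟨i, i.2, rfl⟩)
  choose g c hc hg using hex
  have hinj : Function.Injective g := by
    intro i j hij
    refine Subtype.ext (hv.eq_of_eq_smul (mul_pos (hc i) (inv_pos.2 (hc j))) ?_)
    rw [hg i, hg j, hij, mul_smul, smul_smul (c j)⁻¹, inv_mul_cancel₀ (hc j).ne', one_smul]
  have := (hw.comp g hinj).units_smul fun i => Units.mk0 (c i) (hc i).ne'
  have heq : (fun i : (I : Set (Fin n)) => v i) =
      (fun i => Units.mk0 (c i) (hc i).ne') • (w ∘ g) := by
    funext i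
    exact hg i
  rw [LinearIndepOn, heq]
  exact this

theorem IsRayGenerators.exists_eq_hull (hΔ : IsSimplicialPolytopalFan Δ)
    (hv : IsRayGenerators Δ v) {σ : PointedCone ℝ (EuclideanSpace ℝ (Fin d))} (hσ : σ ∈ Δ) :
    ∃ I : Finset (Fin n), σ = PointedCone.hull ℝ (v '' (I : Set (Fin n))) := by
  classical
  refine ⟨Finset.univ.filter fun i => v i ∈ σ, le_antisymm ?_ (Submodule.span_le.2 ?_)⟩
  · obtain ⟨k, w, hw, rfl⟩ := (hΔ.2 _ hσ).exists_range
    refine Submodule.span_le.2 ?_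
    rintro _ ⟨k, rfl⟩
    obtain ⟨i, c, hc, hk⟩ := hv.exists_eq_smul_of_linearIndependent hΔ hw hσ k
    rw [hk]
    refine PointedCone.smul_mem _ hc.le (Submodule.subset_span ⟨i, ?_, rfl⟩)
    have : w k ∈ PointedCone.hull ℝ (Set.range w) := Submodule.subset_span ⟨k, rfl⟩
    rw [hk, PointedCone.smul_mem_iff _ hc] at this
    simpa using this
  · rintro _ ⟨i, hi, rfl⟩
    simpa using hi

theorem IsRayGenerators.mem_of_mem_hull (hΔ : IsSimplicialPolytopalFan Δ)
    (hv : IsRayGenerators Δ v) {I : Finset (Fin n)}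
    (hI : PointedCone.hull ℝ (v '' (I : Set (Fin n))) ∈ Δ) {i : Fin n}
    (hi : v i ∈ PointedCone.hull ℝ (v '' (I : Set (Fin n)))) : i ∈ I := by
  have himg : v '' (I : Set (Fin n)) = Set.range fun j : I => v j := by
    ext x
    simp
  rw [himg] at hI hi
  obtain ⟨k, c, hc, h⟩ := hv.exists_generator_eq_smul hΔ (w := fun j : I => v j)
    (fun k => hv.ne_zero k) hI hi
  rw [hv.eq_of_eq_smul hc h]
  exact k.2

/-- `c` is the vector of coefficients of `u` as a positive combination of the generators of the
cone of `Δ` spanned by the `v i` with `i ∈ I`. -/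
structure IsPosCoords (Δ : Set (PointedCone ℝ (EuclideanSpace ℝ (Fin d))))
    (v : Fin n → EuclideanSpace ℝ (Fin d)) (u : EuclideanSpace ℝ (Fin d)) (I : Finset (Fin n))
    (c : Fin n → ℝ) : Prop where
  hull_mem : PointedCone.hull ℝ (v '' (I : Set (Fin n))) ∈ Δ
  pos : ∀ i ∈ I, 0 < c i
  eq_zero : ∀ i, i ∉ I → c i = 0
  eq_sum : u = ∑ i, c i • v i

namespace IsPosCoords

variable {u : EuclideanSpace ℝ (Fin d)} {I J : Finset (Fin n)} {c c' : Fin n → ℝ}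

theorem nonneg (h : IsPosCoords Δ v u I c) (i : Fin n) : 0 ≤ c i := by
  by_cases hi : i ∈ I
  · exact (h.pos i hi).le
  · exact (h.eq_zero i hi).ge

theorem mem_hull (h : IsPosCoords Δ v u I c) :
    u ∈ PointedCone.hull ℝ (v '' (I : Set (Fin n))) :=
  mem_hull_image_iff.2 ⟨c, h.nonneg, h.eq_zero, h.eq_sum⟩

theorem mem_of_mem (hΔ : IsSimplicialPolytopalFan Δ) (h : IsPosCoords Δ v u I c)
    {τ : PointedCone ℝ (EuclideanSpace ℝ (Fin d))} (hτ : τ ∈ Δ) (hu : u ∈ τ) {i : Fin n}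
    (hi : i ∈ I) : v i ∈ τ := by
  refine hΔ.mem_of_sum_mem h.hull_mem hτ h.nonneg (fun j hj => ?_) (h.eq_sum ▸ hu) (h.pos i hi)
  refine Submodule.subset_span ⟨j, ?_, rfl⟩
  by_contra hjI
  exact hj.ne' (h.eq_zero j hjI)

theorem subset (hΔ : IsSimplicialPolytopalFan Δ) (hv : IsRayGenerators Δ v)
    (h : IsPosCoords Δ v u I c) (hJ : PointedCone.hull ℝ (v '' (J : Set (Fin n))) ∈ Δ)
    (hu : u ∈ PointedCone.hull ℝ (v '' (J : Set (Fin n)))) : I ⊆ J :=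
  fun _ hi => hv.mem_of_mem_hull hΔ hJ (h.mem_of_mem hΔ hJ hu hi)

/-- The cone indexed by `J` need not be the minimal one containing `u`, nor `c'` nonnegative: since
`I ⊆ J`, both expansions use the same independent family. -/
theorem eq_of_sum_eq (hΔ : IsSimplicialPolytopalFan Δ) (hv : IsRayGenerators Δ v)
    (h : IsPosCoords Δ v u I c) (hJ : PointedCone.hull ℝ (v '' (J : Set (Fin n))) ∈ Δ)
    (hu : u ∈ PointedCone.hull ℝ (v '' (J : Set (Fin n)))) (hc' : ∀ i, i ∉ J → c' i = 0)
    (hsum : u = ∑ i, c' i • v i) : c' = c :=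
  (hv.linearIndepOn hΔ hJ).eq_of_sum_smul_eq hc'
    (fun i hi => h.eq_zero i fun hi' => hi (h.subset hΔ hv hJ hu hi'))
    (hsum.symm.trans h.eq_sum)

end IsPosCoords

/-- The cone is the normal cone of the face exposed by `u`. A vanishing coefficient at `i` would
become `-ε` in `u - ε • v i`, which still lies in the cone. -/
theorem IsRayGenerators.exists_isPosCoords (hΔ : IsSimplicialPolytopalFan Δ)
    (hv : IsRayGenerators Δ v) (u : EuclideanSpace ℝ (Fin d)) :
    ∃ I c, IsPosCoords Δ v u I c := by
  classical
  have hΔ' := hΔ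
  obtain ⟨⟨P, hP, hPΔ⟩, -⟩ := hΔ'
  have hmem : normalCone P (exposedFace P u) ∈ Δ := hPΔ ▸ (mem_normalFan_iff hP).2 ⟨u, rfl⟩
  obtain ⟨I, hI⟩ := hv.exists_eq_hull hΔ hmem
  have hu := mem_normalCone_exposedFace (P := P) u
  rw [hI] at hu
  obtain ⟨c, hc, hc0, hsum⟩ := mem_hull_image_iff.1 hu
  refine ⟨I, c, hI ▸ hmem, fun i hi => lt_of_le_of_ne (hc i) fun h0 => ?_, hc0, hsum⟩
  have hvi : v i ∈ normalCone P (exposedFace P u) := by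
    rw [hI]
    exact Submodule.subset_span ⟨i, hi, rfl⟩
  obtain ⟨ε, hε, hε'⟩ := hP.exists_sub_smul_mem_normalCone hvi
  rw [hI] at hε'
  obtain ⟨e, he, he0, hesum⟩ := mem_hull_image_iff.1 hε'
  have heq : c - ε • Pi.single i 1 = e := by
    refine (hv.linearIndepOn hΔ (hI ▸ hmem)).eq_of_sum_smul_eq (fun j hj => ?_) he0 ?_
    · have : j ≠ i := fun h => hj (h ▸ hi)
      simp [hc0 j hj, this]
    · rw [← hesum, hsum]
      simp [sub_smul, Finset.sum_sub_distrib, Pi.single_apply]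
  have := he i
  rw [← heq] at this
  simp [← h0] at this
  linarith

/-- A linear map sending the vectors `v i`, `i ∈ I`, to the standard unit vectors, and all of whose
coordinates outside `I` vanish. It is meaningful if these vectors are linearly independent. -/
noncomputable def coneCoord (v : Fin n → EuclideanSpace ℝ (Fin d)) (I : Finset (Fin n)) :
    EuclideanSpace ℝ (Fin d) →ₗ[ℝ] (Fin n → ℝ) :=
  Classical.epsilon fun φ : EuclideanSpace ℝ (Fin d) →ₗ[ℝ] (Fin n → ℝ) =>
    (∀ i ∈ I, φ (v i) = Pi.single i 1) ∧ ∀ u, ∀ i, i ∉ I → φ u i = 0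

theorem coneCoord_spec {I : Finset (Fin n)} (hI : LinearIndepOn ℝ v (I : Set (Fin n))) :
    (∀ i ∈ I, coneCoord v I (v i) = Pi.single i 1) ∧ ∀ u, ∀ i, i ∉ I → coneCoord v I u i = 0 := by
  classical
  refine Classical.epsilon_spec (p := fun φ : EuclideanSpace ℝ (Fin d) →ₗ[ℝ] (Fin n → ℝ) =>
    (∀ i ∈ I, φ (v i) = Pi.single i 1) ∧ ∀ u, ∀ i, i ∉ I → φ u i = 0) ?_
  obtain ⟨g, hg⟩ := LinearMap.exists_leftInverse_of_injective
    (Finsupp.linearCombination ℝ fun i : (I : Set (Fin n)) => v i)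
    (LinearMap.ker_eq_bot.2 hI.finsuppLinearCombination_injective)
  refine ⟨LinearMap.pi fun i => if h : i ∈ I then Finsupp.lapply ⟨i, h⟩ ∘ₗ g else 0,
    fun i hi => ?_, fun u i hi => ?_⟩
  · have h1 : g (v i) = Finsupp.single ⟨i, hi⟩ 1 := by
      have := LinearMap.congr_fun hg (Finsupp.single ⟨i, hi⟩ 1)
      simpa using this
    funext j
    by_cases hj : j ∈ I
    · by_cases hij : i = j
      · subst hij
        simp [hi, h1]
      · simp [hj, h1, Ne.symm hij, Subtype.ext_iff]
    · have : j ≠ i := fun h => hj (h ▸ hi)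
      simp [hj, this]
  · simp [hi]

theorem coneCoord_sum {I : Finset (Fin n)} (hI : LinearIndepOn ℝ v (I : Set (Fin n)))
    {c : Fin n → ℝ} (hc : ∀ i, i ∉ I → c i = 0) : coneCoord v I (∑ i, c i • v i) = c := by
  have h : ∀ i, coneCoord v I (c i • v i) = c i • Pi.single i 1 := by
    intro i
    by_cases hi : i ∈ I
    · rw [map_smul, (coneCoord_spec hI).1 i hi]
    · rw [hc i hi, zero_smul, zero_smul, map_zero]
  rw [map_sum, Finset.sum_congr rfl fun i _ => h i]
  funext j
  simp [Finset.sum_apply, Pi.single_apply]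

theorem IsPosCoords.isRayCoords (hΔ : IsSimplicialPolytopalFan Δ) (hv : IsRayGenerators Δ v)
    {u : EuclideanSpace ℝ (Fin d)} {I : Finset (Fin n)} {c : Fin n → ℝ}
    (h : IsPosCoords Δ v u I c) : IsRayCoords Δ v u c := by
  have hli := hv.linearIndepOn hΔ h.hull_mem
  refine ⟨_, h.hull_mem, ?_, I, rfl, ?_, h.eq_zero⟩
  · set σ : Set (EuclideanSpace ℝ (Fin d)) :=
      (PointedCone.hull ℝ (v '' (I : Set (Fin n))) : Set (EuclideanSpace ℝ (Fin d)))
    have huσ : u ∈ σ := h.mem_hull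
    rw [mem_intrinsicInterior]
    refine ⟨⟨u, subset_affineSpan ℝ σ huσ⟩, ?_, rfl⟩
    rw [mem_interior]
    -- Positivity of all cone coordinates is open and, within the span, forces membership in the
    -- cone.
    refine ⟨{y | ∀ i ∈ I, 0 < coneCoord v I (y : EuclideanSpace ℝ (Fin d)) i}, ?_, ?_, ?_⟩
    · rintro ⟨y, hy⟩ hpos
      have hspan : y ∈ Submodule.span ℝ (v '' (I : Set (Fin n))) := by
        have h1 : affineSpan ℝ σ ≤
            (Submodule.span ℝ (v '' (I : Set (Fin n)))).toAffineSubspace := by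
          rw [affineSpan_le]
          exact PointedCone.hull_le_span ℝ _
        exact h1 hy
      rw [Submodule.mem_span_image_finset_iff_exists_fun] at hspan
      obtain ⟨a, rfl⟩ := hspan
      refine Submodule.sum_mem _ fun i _ => PointedCone.smul_mem _ ?_
        (Submodule.subset_span ⟨i, i.2, rfl⟩)
      have h2 := hpos i i.2
      rw [map_sum, Finset.sum_apply,
        Finset.sum_eq_single i (fun j _ hj => ?_) (by simp)] at h2
      · rw [map_smul, (coneCoord_spec hli).1 i i.2] at h2
        simpa using h2.le
      · rw [map_smul, (coneCoord_spec hli).1 j j.2]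
        have : (i : Fin n) ≠ j := fun h => hj (Subtype.ext h.symm)
        simp [this]
    · simp only [Set.ofPred_forall]
      refine isOpen_biInter_finset fun i _ => isOpen_lt continuous_const ?_
      exact (continuous_apply i).comp
        ((coneCoord v I).continuous_of_finiteDimensional.comp continuous_subtype_val)
    · intro i hi
      change 0 < coneCoord v I u i
      rw [h.eq_sum, coneCoord_sum hli h.eq_zero]
      exact h.pos i hi
  · rw [h.eq_sum]
    exact (Finset.sum_subset (Finset.subset_univ I)
      (fun i _ hi => by rw [h.eq_zero i hi, zero_smul])).symm

/-- Uniqueness uses only that `u` lies in the chosen cone; relative interiority matters for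
existence alone. -/
theorem IsPosCoords.rayCoords_eq (hΔ : IsSimplicialPolytopalFan Δ) (hv : IsRayGenerators Δ v)
    {u : EuclideanSpace ℝ (Fin d)} {I : Finset (Fin n)} {c : Fin n → ℝ}
    (h : IsPosCoords Δ v u I c) : rayCoords Δ v u = c := by
  obtain ⟨σ, hσ, hu, J, rfl, hsum, h0⟩ : IsRayCoords Δ v u (rayCoords Δ v u) :=
    Classical.epsilon_spec (p := fun c => IsRayCoords Δ v u c) ⟨c, h.isRayCoords hΔ hv⟩
  refine h.eq_of_sum_eq hΔ hv hσ (intrinsicInterior_subset hu) h0 ?_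
  conv_lhs => rw [hsum]
  exact Finset.sum_subset (Finset.subset_univ J) (fun i _ hi => by rw [h0 i hi, zero_smul])

theorem IsRayGenerators.isPosCoords_rayCoords (hΔ : IsSimplicialPolytopalFan Δ)
    (hv : IsRayGenerators Δ v) (u : EuclideanSpace ℝ (Fin d)) :
    ∃ I, IsPosCoords Δ v u I (rayCoords Δ v u) := by
  obtain ⟨I, c, h⟩ := hv.exists_isPosCoords hΔ u
  exact ⟨I, (h.rayCoords_eq hΔ hv).symm ▸ h⟩

theorem IsRayGenerators.rayCoords_nonneg (hΔ : IsSimplicialPolytopalFan Δ)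
    (hv : IsRayGenerators Δ v) (u : EuclideanSpace ℝ (Fin d)) (i : Fin n) :
    0 ≤ rayCoords Δ v u i := by
  obtain ⟨I, h⟩ := hv.isPosCoords_rayCoords hΔ u
  exact h.nonneg i

theorem IsRayGenerators.sum_rayCoords (hΔ : IsSimplicialPolytopalFan Δ)
    (hv : IsRayGenerators Δ v) (u : EuclideanSpace ℝ (Fin d)) :
    ∑ i, rayCoords Δ v u i • v i = u := by
  obtain ⟨I, h⟩ := hv.isPosCoords_rayCoords hΔ u
  exact h.eq_sum.symm

theorem IsRayGenerators.rayCoords_eq_coneCoord (hΔ : IsSimplicialPolytopalFan Δ)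
    (hv : IsRayGenerators Δ v) {u : EuclideanSpace ℝ (Fin d)} {I : Finset (Fin n)}
    (hI : PointedCone.hull ℝ (v '' (I : Set (Fin n))) ∈ Δ)
    (hu : u ∈ PointedCone.hull ℝ (v '' (I : Set (Fin n)))) :
    rayCoords Δ v u = coneCoord v I u := by
  obtain ⟨c, -, hc0, hsum⟩ := mem_hull_image_iff.1 hu
  obtain ⟨J, h⟩ := hv.isPosCoords_rayCoords hΔ u
  rw [← h.eq_of_sum_eq hΔ hv hI hu hc0 hsum, hsum, coneCoord_sum (hv.linearIndepOn hΔ hI) hc0]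

theorem IsRayGenerators.rayCoords_generator (hΔ : IsSimplicialPolytopalFan Δ)
    (hv : IsRayGenerators Δ v) (i : Fin n) : rayCoords Δ v (v i) = Pi.single i 1 := by
  have himg : v '' (({i} : Finset (Fin n)) : Set (Fin n)) = {v i} := by simp
  have hI : PointedCone.hull ℝ (v '' (({i} : Finset (Fin n)) : Set (Fin n))) ∈ Δ := by
    rw [himg]
    exact hv.hull_mem i
  rw [hv.rayCoords_eq_coneCoord hΔ hI (Submodule.subset_span ⟨i, by simp, rfl⟩)]
  exact (coneCoord_spec (hv.linearIndepOn hΔ hI)).1 i (Finset.mem_singleton_self i)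

/-- Linear maps on finitely many closed cones covering the space, glued along the overlaps. -/
theorem IsRayGenerators.continuous_rayCoords (hΔ : IsSimplicialPolytopalFan Δ)
    (hv : IsRayGenerators Δ v) : Continuous (rayCoords Δ v) := by
  refine LocallyFinite.continuous
    (f := fun I : {I : Finset (Fin n) // PointedCone.hull ℝ (v '' (I : Set (Fin n))) ∈ Δ} =>
      (PointedCone.hull ℝ (v '' (I.1 : Set (Fin n))) : Set (EuclideanSpace ℝ (Fin d))))
    (locallyFinite_of_finite _) ?_ (fun I => hΔ.isClosed I.2) fun I => ?_
  · refine Set.eq_univ_of_forall fun u => Set.mem_iUnion.2 ?_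
    obtain ⟨I, h⟩ := hv.isPosCoords_rayCoords hΔ u
    exact ⟨⟨I, h.hull_mem⟩, h.mem_hull⟩
  · exact (coneCoord v I.1).continuous_of_finiteDimensional.continuousOn.congr
      fun u hu => hv.rayCoords_eq_coneCoord hΔ I.2 hu

end Fan

/-! ### Support functions on the deformation cone. -/

section DeformationCone

variable {d n : ℕ} {Δ : Set (PointedCone ℝ (EuclideanSpace ℝ (Fin d)))}
  {v : Fin n → EuclideanSpace ℝ (Fin d)} {Q Q' : Set (EuclideanSpace ℝ (Fin d))}
  {I : Finset (Fin n)}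

theorem isPosCoords_sum (hI : PointedCone.hull ℝ (v '' (I : Set (Fin n))) ∈ Δ) :
    IsPosCoords Δ v (∑ i ∈ I, v i) I (fun i => if i ∈ I then 1 else 0) where
  hull_mem := hI
  pos i hi := by simp [hi]
  eq_zero i hi := by simp [hi]
  eq_sum := by simp [ite_smul]

/-- Maximise the sum of the generators. Its normal cone on `Q` is a union of cones of `Δ`; the one
containing the sum contains every generator, so the same point maximises all of them. -/
theorem exists_mem_inner_eq_supportFun (hΔ : IsSimplicialPolytopalFan Δ)
    (hQ : Q ∈ deformationCone Δ) (hI : PointedCone.hull ℝ (v '' (I : Set (Fin n))) ∈ Δ) :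
    ∃ x ∈ Q, ∀ i ∈ I, ⟪v i, x⟫_ℝ = supportFun Q (v i) := by
  set u := ∑ i ∈ I, v i
  obtain ⟨S, hS, hτ⟩ := hQ.2 _ ((mem_normalFan_iff hQ.1).2 ⟨u, rfl⟩)
  have hu : u ∈ (normalCone Q (exposedFace Q u) : Set (EuclideanSpace ℝ (Fin d))) :=
    mem_normalCone_exposedFace u
  rw [hτ] at hu
  obtain ⟨σ, hσ, huσ⟩ := Set.mem_iUnion₂.1 hu
  obtain ⟨x, hx⟩ := hQ.1.exposedFace_nonempty u
  refine ⟨x, hx.1, fun i hi => ?_⟩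
  have h1 : v i ∈ (normalCone Q (exposedFace Q u) : Set (EuclideanSpace ℝ (Fin d))) := by
    rw [hτ]
    exact Set.mem_iUnion₂.2 ⟨σ, hσ, (isPosCoords_sum hI).mem_of_mem hΔ (hS hσ) huσ hi⟩
  have h2 : x ∈ exposedFace Q (v i) := ⟨hx.1, fun y hy => h1 x hx y hy⟩
  exact (supportFun_eq_of_mem_exposedFace h2).symm

theorem IsRayGenerators.inner_eq_sum_rayCoords (hΔ : IsSimplicialPolytopalFan Δ)
    (hv : IsRayGenerators Δ v) (u x : EuclideanSpace ℝ (Fin d)) :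
    ⟪u, x⟫_ℝ = ∑ i, rayCoords Δ v u i * ⟪v i, x⟫_ℝ := by
  conv_lhs => rw [← hv.sum_rayCoords hΔ u]
  simp only [sum_inner, real_inner_smul_left]

/-- Support functions of polytopes in the deformation cone are linear on the cones of `Δ`. -/
theorem supportFun_eq_sum_rayCoords (hΔ : IsSimplicialPolytopalFan Δ) (hv : IsRayGenerators Δ v)
    (hQ : Q ∈ deformationCone Δ) (u : EuclideanSpace ℝ (Fin d)) :
    supportFun Q u = ∑ i, rayCoords Δ v u i * supportFun Q (v i) := by
  obtain ⟨I, hI⟩ := hv.isPosCoords_rayCoords hΔ u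
  obtain ⟨x, hx, hxI⟩ := exists_mem_inner_eq_supportFun hΔ hQ hI.hull_mem
  have hsum : ⟪u, x⟫_ℝ = ∑ i, rayCoords Δ v u i * supportFun Q (v i) := by
    rw [hv.inner_eq_sum_rayCoords hΔ]
    refine Finset.sum_congr rfl fun i _ => ?_
    by_cases hi : i ∈ I
    · rw [hxI i hi]
    · rw [hI.eq_zero i hi, zero_mul, zero_mul]
  rw [← hsum]
  refine supportFun_eq_of_mem_exposedFace ⟨hx, fun y hy => ?_⟩
  rw [hsum, hv.inner_eq_sum_rayCoords hΔ]
  exact Finset.sum_le_sum fun i _ => mul_le_mul_of_nonneg_left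
    (hQ.1.inner_le_supportFun _ hy) (hv.rayCoords_nonneg hΔ u i)

theorem eq_of_supportFun_eq (hΔ : IsSimplicialPolytopalFan Δ) (hv : IsRayGenerators Δ v)
    (hQ : Q ∈ deformationCone Δ) (hQ' : Q' ∈ deformationCone Δ)
    (h : ∀ i, supportFun Q (v i) = supportFun Q' (v i)) : Q = Q' := by
  ext x
  rw [hQ.1.mem_iff, hQ'.1.mem_iff]
  refine forall_congr' fun u => ?_
  rw [supportFun_eq_sum_rayCoords hΔ hv hQ, supportFun_eq_sum_rayCoords hΔ hv hQ']
  simp only [h]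

/-- The deformation cone in the coordinates given by the values of the support function at the
ray generators. -/
def supportVectors (Δ : Set (PointedCone ℝ (EuclideanSpace ℝ (Fin d))))
    (v : Fin n → EuclideanSpace ℝ (Fin d)) : Set (Fin n → ℝ) :=
  {h | ∃ Q ∈ deformationCone Δ, ∀ i, supportFun Q (v i) = h i}

/-- The fan is complete, so each `±e j` is a nonnegative combination of the `v i`, and the given
upper bounds control every coordinate. -/
theorem IsRayGenerators.exists_norm_le (hΔ : IsSimplicialPolytopalFan Δ)
    (hv : IsRayGenerators Δ v) : ∃ C : ℝ, 0 ≤ C ∧ ∀ (h : Fin n → ℝ) (x : EuclideanSpace ℝ (Fin d)),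
      (∀ i, ⟪v i, x⟫_ℝ ≤ h i) → ‖x‖ ≤ C * ‖h‖ := by
  set e : Fin d → EuclideanSpace ℝ (Fin d) := fun j => EuclideanSpace.basisFun (Fin d) ℝ j with he
  have hnn := hv.rayCoords_nonneg hΔ
  refine ⟨∑ j, ((∑ i, rayCoords Δ v (e j) i) + ∑ i, rayCoords Δ v (-e j) i),
    Finset.sum_nonneg fun j _ => add_nonneg (Finset.sum_nonneg fun i _ => hnn _ i)
      (Finset.sum_nonneg fun i _ => hnn _ i), fun h x hx => ?_⟩
  have hle : ∀ u, ⟪u, x⟫_ℝ ≤ (∑ i, rayCoords Δ v u i) * ‖h‖ := by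
    intro u
    rw [hv.inner_eq_sum_rayCoords hΔ, Finset.sum_mul]
    refine Finset.sum_le_sum fun i _ => mul_le_mul_of_nonneg_left ((hx i).trans ?_) (hnn u i)
    exact (le_abs_self _).trans (norm_le_pi_norm h i)
  have hx' : x = ∑ j, ⟪e j, x⟫_ℝ • e j := ((EuclideanSpace.basisFun (Fin d) ℝ).sum_repr' x).symm
  have hnorm : ‖x‖ ≤ ∑ j, ‖⟪e j, x⟫_ℝ • e j‖ := by
    conv_lhs => rw [hx']
    exact norm_sum_le _ _
  refine hnorm.trans ?_
  rw [Finset.sum_mul]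
  refine Finset.sum_le_sum fun j _ => ?_
  rw [norm_smul, (EuclideanSpace.basisFun (Fin d) ℝ).norm_eq_one j, mul_one, Real.norm_eq_abs,
    add_mul]
  have h1 := hle (e j)
  have h2 := hle (-e j)
  rw [inner_neg_left] at h2
  have h3 : 0 ≤ (∑ i, rayCoords Δ v (e j) i) * ‖h‖ :=
    mul_nonneg (Finset.sum_nonneg fun i _ => hnn _ i) (norm_nonneg _)
  have h4 : 0 ≤ (∑ i, rayCoords Δ v (-e j) i) * ‖h‖ :=
    mul_nonneg (Finset.sum_nonneg fun i _ => hnn _ i) (norm_nonneg _)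
  exact abs_le.2 ⟨by linarith, by linarith⟩

/-- This reduces convexity, closedness and the neighbourhood property to handling a witness `x` for
each cone separately. -/
theorem mem_supportVectors_iff (hΔ : IsSimplicialPolytopalFan Δ) (hv : IsRayGenerators Δ v)
    {h : Fin n → ℝ} : h ∈ supportVectors Δ v ↔
      ∀ I : Finset (Fin n), PointedCone.hull ℝ (v '' (I : Set (Fin n))) ∈ Δ →
        ∃ x, (∀ i ∈ I, ⟪v i, x⟫_ℝ = h i) ∧ ∀ k, ⟪v k, x⟫_ℝ ≤ h k := by
  classical
  constructor
  · rintro ⟨Q, hQ, hQh⟩ I hI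
    obtain ⟨x, hx, hxI⟩ := exists_mem_inner_eq_supportFun hΔ hQ hI
    exact ⟨x, fun i hi => (hxI i hi).trans (hQh i),
      fun k => (hQ.1.inner_le_supportFun _ hx).trans (hQh k).le⟩
  · intro H
    set Q : Set (EuclideanSpace ℝ (Fin d)) := {x | ∀ k, ⟪v k, x⟫_ℝ ≤ h k} with hQdef
    have hle : ∀ u, ∀ x ∈ Q, ⟪u, x⟫_ℝ ≤ ∑ i, rayCoords Δ v u i * h i := by
      intro u x hx
      rw [hv.inner_eq_sum_rayCoords hΔ]
      exact Finset.sum_le_sum fun i _ =>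
        mul_le_mul_of_nonneg_left (hx i) (hv.rayCoords_nonneg hΔ u i)
    have hex : ∀ u, ∃ x ∈ Q, ⟪u, x⟫_ℝ = ∑ i, rayCoords Δ v u i * h i := by
      intro u
      obtain ⟨I, hI⟩ := hv.isPosCoords_rayCoords hΔ u
      obtain ⟨x, hxI, hx⟩ := H I hI.hull_mem
      refine ⟨x, hx, ?_⟩
      rw [hv.inner_eq_sum_rayCoords hΔ]
      refine Finset.sum_congr rfl fun i _ => ?_
      by_cases hi : i ∈ I
      · rw [hxI i hi]
      · rw [hI.eq_zero i hi, zero_mul, zero_mul]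
    have hface : ∀ u x, x ∈ exposedFace Q u ↔ x ∈ Q ∧ ⟪u, x⟫_ℝ = ∑ i, rayCoords Δ v u i * h i := by
      intro u x
      obtain ⟨z, hz, hzu⟩ := hex u
      constructor
      · exact fun hx => ⟨hx.1, le_antisymm (hle u x hx.1) (hzu ▸ hx.2 z hz)⟩
      · exact fun hx => ⟨hx.1, fun y hy => hx.2 ▸ hle u y hy⟩
    have hpoly : IsPolytope Q := by
      refine ⟨(hex 0).imp fun x hx => hx.1, ?_, Finset.univ.image fun k => (v k, h k), ?_⟩
      · obtain ⟨C, -, hC⟩ := hv.exists_norm_le hΔ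
        exact isBounded_iff_forall_norm_le.2 ⟨C * ‖h‖, fun x hx => hC h x hx⟩
      · ext x
        simp [hQdef]
    refine ⟨Q, ⟨hpoly, fun τ hτ => ?_⟩, fun i => ?_⟩
    · obtain ⟨l, rfl⟩ := (mem_normalFan_iff hpoly).1 hτ
      refine ⟨{σ | σ ∈ Δ ∧ σ ≤ normalCone Q (exposedFace Q l)}, fun σ hσ => hσ.1, ?_⟩
      refine Set.Subset.antisymm (fun u hu => ?_) (Set.iUnion₂_subset fun σ hσ => hσ.2)
      obtain ⟨I, hI⟩ := hv.isPosCoords_rayCoords hΔ u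
      refine Set.mem_iUnion₂.2 ⟨_, ⟨hI.hull_mem, Submodule.span_le.2 ?_⟩, hI.mem_hull⟩
      rintro _ ⟨i, hi, rfl⟩ p hp y hy
      have hpu : p ∈ exposedFace Q u := ⟨hp.1, hu p hp⟩
      have hsum := ((hface u p).1 hpu).2
      -- Equality of sums with termwise `≤` forces equality for each term, hence tightness at every
      -- `i ∈ I`.
      rw [hv.inner_eq_sum_rayCoords hΔ, Finset.sum_eq_sum_iff_of_le fun j _ =>
        mul_le_mul_of_nonneg_left (hp.1 j) (hv.rayCoords_nonneg hΔ u j)] at hsum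
      rw [mul_left_cancel₀ (hI.pos i hi).ne' (hsum i (Finset.mem_univ i))]
      exact hy i
    · obtain ⟨x, hx⟩ := hpoly.exposedFace_nonempty (v i)
      rw [supportFun_eq_of_mem_exposedFace hx, ((hface _ x).1 hx).2, hv.rayCoords_generator hΔ]
      simp [Pi.single_apply]

theorem convex_supportVectors (hΔ : IsSimplicialPolytopalFan Δ) (hv : IsRayGenerators Δ v) :
    Convex ℝ (supportVectors Δ v) := by
  intro f hf g hg a b ha hb hab
  rw [mem_supportVectors_iff hΔ hv] at hf hg ⊢
  intro I hI
  obtain ⟨x, hxI, hx⟩ := hf I hI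
  obtain ⟨y, hyI, hy⟩ := hg I hI
  refine ⟨a • x + b • y, fun i hi => ?_, fun k => ?_⟩
  · simp [inner_add_right, real_inner_smul_right, hxI i hi, hyI i hi]
  · have h1 := mul_le_mul_of_nonneg_left (hx k) ha
    have h2 := mul_le_mul_of_nonneg_left (hy k) hb
    simp only [inner_add_right, real_inner_smul_right, Pi.add_apply, Pi.smul_apply, smul_eq_mul]
    linarith

/-- The witnesses of a convergent sequence are bounded by `exists_norm_le`; a subsequential limit is
a witness for the limit vector. -/
theorem isClosed_supportVectors (hΔ : IsSimplicialPolytopalFan Δ) (hv : IsRayGenerators Δ v) :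
    IsClosed (supportVectors Δ v) := by
  rw [← isSeqClosed_iff_isClosed]
  intro f g hf hfg
  rw [mem_supportVectors_iff hΔ hv]
  intro I hI
  have hex := fun k => (mem_supportVectors_iff hΔ hv).1 (hf k) I hI
  choose x hxI hx using hex
  obtain ⟨C, hC0, hC⟩ := hv.exists_norm_le hΔ
  obtain ⟨R, hR⟩ := isBounded_iff_forall_norm_le.1 (Metric.isBounded_range_of_tendsto f hfg)
  have hb : ∀ k, x k ∈ Metric.closedBall (0 : EuclideanSpace ℝ (Fin d)) (C * R) := fun k => by
    rw [mem_closedBall_zero_iff]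
    exact (hC _ _ (hx k)).trans (mul_le_mul_of_nonneg_left (hR _ ⟨k, rfl⟩) hC0)
  obtain ⟨a, -, φ, hφ, ha⟩ := tendsto_subseq_of_bounded Metric.isBounded_closedBall hb
  have hlim : ∀ i, Filter.Tendsto (fun k => f (φ k) i) Filter.atTop (nhds (g i)) := fun i =>
    ((tendsto_pi_nhds.1 hfg) i).comp hφ.tendsto_atTop
  have hlim' : ∀ i, Filter.Tendsto (fun k => ⟪v i, x (φ k)⟫_ℝ) Filter.atTop (nhds ⟪v i, a⟫_ℝ) :=
    fun i => tendsto_const_nhds.inner ha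
  refine ⟨a, fun i hi => tendsto_nhds_unique (hlim' i) ?_,
    fun i => le_of_tendsto_of_tendsto' (hlim' i) (hlim i) fun k => hx (φ k) i⟩
  simpa only [hxI _ i hi] using hlim i

theorem exists_dual_vectors (hI : LinearIndepOn ℝ v (I : Set (Fin n))) :
    ∃ g : Fin n → EuclideanSpace ℝ (Fin d),
      ∀ i ∈ I, ∀ j, ⟪v i, g j⟫_ℝ = (Pi.single i 1 : Fin n → ℝ) j := by
  refine ⟨fun j => (InnerProductSpace.toDual ℝ _).symm
    (LinearMap.toContinuousLinearMap (LinearMap.proj j ∘ₗ coneCoord v I)), fun i hi j => ?_⟩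
  rw [real_inner_comm, InnerProductSpace.toDual_symm_apply]
  simp [(coneCoord_spec hI).1 i hi]

/-- For each cone, choose a point of the matching face of `P` at which all constraints outside `I`
are slack. Shifting it along dual vectors, which exist by linear independence, restores tightness on
`I` for any nearby `h`, and the slack persists. -/
theorem supportVectors_mem_nhds {P : Set (EuclideanSpace ℝ (Fin d))} (hP : IsPolytope P)
    (hΔ : IsSimplicialPolytopalFan (normalFan P)) (hv : IsRayGenerators (normalFan P) v) :
    supportVectors (normalFan P) v ∈ nhds fun i => supportFun P (v i) := by
  classical
  have hmem : supportVectors (normalFan P) v = {h | ∀ I : Finset (Fin n),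
      PointedCone.hull ℝ (v '' (I : Set (Fin n))) ∈ normalFan P →
        ∃ x, (∀ i ∈ I, ⟪v i, x⟫_ℝ = h i) ∧ ∀ k, ⟪v k, x⟫_ℝ ≤ h k} :=
    Set.ext fun h => mem_supportVectors_iff hΔ hv
  rw [hmem]
  refine Filter.eventually_all.2 fun I => ?_
  by_cases hI : PointedCone.hull ℝ (v '' (I : Set (Fin n))) ∈ normalFan P
  swap
  · exact Filter.Eventually.of_forall fun h hI' => absurd hI' hI
  obtain ⟨u₀, hu₀⟩ := (mem_normalFan_iff hP).1 hI
  -- Slackness is gained one generator at a time: as `v k` is not in the cone, some point `q` of the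
  -- face is slack at `k`, and averaging with `q` keeps earlier strict inequalities.
  have hstrict : ∀ T : Finset (Fin n), ∃ p ∈ exposedFace P u₀,
      ∀ k ∈ T, k ∉ I → ⟪v k, p⟫_ℝ < supportFun P (v k) := by
    intro T
    induction T using Finset.induction_on with
    | empty =>
      obtain ⟨p, hp⟩ := hP.exposedFace_nonempty u₀
      exact ⟨p, hp, by simp⟩
    | insert k T _ ih =>
      obtain ⟨p, hp, hpT⟩ := ih
      by_cases hk : k ∈ I
      · exact ⟨p, hp, fun j hj hjI => (Finset.mem_insert.1 hj).elim
          (fun h => absurd (h ▸ hk) hjI) fun h => hpT j h hjI⟩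
      have hkσ : v k ∉ normalCone P (exposedFace P u₀) := by
        rw [← hu₀]
        exact fun h => hk (hv.mem_of_mem_hull hΔ hI h)
      rw [mem_normalCone] at hkσ
      push Not at hkσ
      obtain ⟨q, hq, y, hy, hlt⟩ := hkσ
      have hqk := hlt.trans_le (hP.inner_le_supportFun (v k) hy)
      have hle : ∀ j, ⟪v j, p⟫_ℝ ≤ supportFun P (v j) ∧ ⟪v j, q⟫_ℝ ≤ supportFun P (v j) :=
        fun j => ⟨hP.inner_le_supportFun _ hp.1, hP.inner_le_supportFun _ hq.1⟩
      have hmid : ∀ u, ⟪u, (1 / 2 : ℝ) • p + (1 / 2 : ℝ) • q⟫_ℝ =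
          1 / 2 * ⟪u, p⟫_ℝ + 1 / 2 * ⟪u, q⟫_ℝ := fun u => by
        rw [inner_add_right, real_inner_smul_right, real_inner_smul_right]
      refine ⟨(1 / 2 : ℝ) • p + (1 / 2 : ℝ) • q, (mem_exposedFace_iff hP).2
        ⟨hP.convex hp.1 hq.1 (by norm_num) (by norm_num) (by norm_num), ?_⟩, fun j hj hjI => ?_⟩
      · rw [hmid, ((mem_exposedFace_iff hP).1 hp).2, ((mem_exposedFace_iff hP).1 hq).2]
        ring
      · rw [hmid]
        have := hle j
        rcases Finset.mem_insert.1 hj with rfl | hjT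
        · linarith
        · have := hpT j hjT hjI
          linarith
  obtain ⟨p, hp, hlt⟩ := hstrict Finset.univ
  have heq : ∀ i ∈ I, ⟪v i, p⟫_ℝ = supportFun P (v i) := by
    intro i hi
    have hvi : v i ∈ normalCone P (exposedFace P u₀) := by
      rw [← hu₀]
      exact Submodule.subset_span ⟨i, hi, rfl⟩
    exact (supportFun_eq_of_mem_exposedFace ⟨hp.1, fun y hy => hvi p hp y hy⟩).symm
  obtain ⟨g, hg⟩ := exists_dual_vectors (hv.linearIndepOn hΔ hI)
  set x : (Fin n → ℝ) → EuclideanSpace ℝ (Fin d) :=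
    fun h => p + ∑ j, (h j - supportFun P (v j)) • g j with hx
  have hxc : Continuous x := by fun_prop
  have hx0 : x (fun i => supportFun P (v i)) = p := by simp [hx]
  have hxI : ∀ h, ∀ i ∈ I, ⟪v i, x h⟫_ℝ = h i := by
    intro h i hi
    simp only [hx, inner_add_right, inner_sum, real_inner_smul_right, hg i hi, heq i hi]
    simp [Pi.single_apply]
  have hev : ∀ᶠ h in nhds fun i => supportFun P (v i), ∀ k, ⟪v k, x h⟫_ℝ ≤ h k := by
    refine Filter.eventually_all.2 fun k => ?_
    by_cases hk : k ∈ I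
    · exact Filter.Eventually.of_forall fun h => (hxI h k hk).le
    · have hc : Continuous fun h : Fin n → ℝ => h k - ⟪v k, x h⟫_ℝ := by fun_prop
      have h0 : 0 < supportFun P (v k) - ⟪v k, x fun i => supportFun P (v i)⟫_ℝ := by
        rw [hx0]
        exact sub_pos.2 (hlt k (Finset.mem_univ k) hk)
      filter_upwards [hc.continuousAt.eventually_const_lt h0] with h hh
      linarith
  filter_upwards [hev] with h hh _
  exact ⟨x h, hxI h, hh⟩

end DeformationCone

/-! ### Least squares in support coordinates: uniqueness as injectivity. -/

section LeastSquares

variable {d n m : ℕ} {Δ : Set (PointedCone ℝ (EuclideanSpace ℝ (Fin d)))}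
  {v : Fin n → EuclideanSpace ℝ (Fin d)} {Q : Set (EuclideanSpace ℝ (Fin d))}

/-- The matrix whose rows are the vectors `[u⁽ʲ⁾]`. -/
noncomputable def rayMatrix (Δ : Set (PointedCone ℝ (EuclideanSpace ℝ (Fin d))))
    (v : Fin n → EuclideanSpace ℝ (Fin d)) (U : Fin m → EuclideanSpace ℝ (Fin d)) :
    Matrix (Fin m) (Fin n) ℝ :=
  Matrix.of fun j i => rayCoords Δ v (U j) i

theorem lsLoss_eq (hΔ : IsSimplicialPolytopalFan Δ) (hv : IsRayGenerators Δ v)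
    (hQ : Q ∈ deformationCone Δ) (U : Fin m → EuclideanSpace ℝ (Fin d)) (y : Fin m → ℝ) :
    lsLoss U y Q = 1 / (m : ℝ) *
      ∑ j, ((rayMatrix Δ v U).mulVec (fun i => supportFun Q (v i)) j - y j) ^ 2 := by
  rw [lsLoss]
  congr 1
  refine Finset.sum_congr rfl fun j _ => ?_
  rw [supportFun_eq_sum_rayCoords hΔ hv hQ (U j)]
  rfl

/-- `K` may be unbounded, but its image under an injective linear map is closed, so it has a point
nearest to `y`. -/
theorem exists_isMinOn_sum_sq {A : Matrix (Fin m) (Fin n) ℝ} (hA : Function.Injective A.mulVec)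
    {K : Set (Fin n → ℝ)} (hK : IsClosed K) (hne : K.Nonempty) (y : Fin m → ℝ) :
    ∃ h ∈ K, ∀ g ∈ K, ∑ j, (A.mulVec h j - y j) ^ 2 ≤ ∑ j, (A.mulVec g j - y j) ^ 2 := by
  set f : (Fin n → ℝ) →ₗ[ℝ] EuclideanSpace ℝ (Fin m) :=
    (WithLp.linearEquiv 2 ℝ (Fin m → ℝ)).symm.toLinearMap ∘ₗ A.mulVecLin
  have hf : LinearMap.ker f = ⊥ := by
    refine LinearMap.ker_eq_bot.2 fun a b hab => hA ?_
    exact (WithLp.linearEquiv 2 ℝ (Fin m → ℝ)).symm.injective hab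
  have hcl : IsClosed (f '' K) := (LinearMap.isClosedEmbedding_of_injective hf).isClosedMap K hK
  obtain ⟨_, ⟨h, hh, rfl⟩, hmin⟩ :=
    hcl.exists_infDist_eq_dist (hne.image f) (WithLp.toLp 2 y)
  refine ⟨h, hh, fun g hg => ?_⟩
  have hle : dist (WithLp.toLp 2 y) (f h) ≤ dist (WithLp.toLp 2 y) (f g) :=
    hmin ▸ Metric.infDist_le_dist_of_mem ⟨g, hg, rfl⟩
  have hd : ∀ g, dist (WithLp.toLp 2 y) (f g) ^ 2 = ∑ j, (A.mulVec g j - y j) ^ 2 := by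
    intro g
    rw [dist_comm, EuclideanSpace.dist_sq_eq]
    refine Finset.sum_congr rfl fun j _ => ?_
    rw [Real.dist_eq, sq_abs]
    rfl
  rw [← hd, ← hd]
  exact pow_le_pow_left₀ dist_nonneg hle 2

theorem eq_of_isMinOn_sum_sq {A : Matrix (Fin m) (Fin n) ℝ} (hA : Function.Injective A.mulVec)
    {K : Set (Fin n → ℝ)} (hK : Convex ℝ K) {y : Fin m → ℝ} {f g : Fin n → ℝ} (hf : f ∈ K)
    (hg : g ∈ K) (hfmin : ∀ h ∈ K, ∑ j, (A.mulVec f j - y j) ^ 2 ≤ ∑ j, (A.mulVec h j - y j) ^ 2)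
    (hgmin : ∀ h ∈ K, ∑ j, (A.mulVec g j - y j) ^ 2 ≤ ∑ j, (A.mulVec h j - y j) ^ 2) :
    f = g := by
  have h1 := hfmin _ (hK hf hg (a := 1 / 2) (b := 1 / 2) (by norm_num) (by norm_num)
    (by norm_num))
  have h2 := hgmin f hf
  -- Parallelogram identity: the midpoint would beat both minimisers unless their images agree.
  have h3 : ∑ j, (A.mulVec ((1 / 2 : ℝ) • f + (1 / 2 : ℝ) • g) j - y j) ^ 2 =
      1 / 2 * ∑ j, (A.mulVec f j - y j) ^ 2 + 1 / 2 * ∑ j, (A.mulVec g j - y j) ^ 2 -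
        1 / 4 * ∑ j, (A.mulVec f j - A.mulVec g j) ^ 2 := by
    rw [Finset.mul_sum, Finset.mul_sum, Finset.mul_sum, ← Finset.sum_add_distrib,
      ← Finset.sum_sub_distrib]
    refine Finset.sum_congr rfl fun j _ => ?_
    rw [Matrix.mulVec_add, Matrix.mulVec_smul, Matrix.mulVec_smul]
    simp only [Pi.add_apply, Pi.smul_apply, smul_eq_mul]
    ring
  have h4 : ∑ j, (A.mulVec f j - A.mulVec g j) ^ 2 = 0 :=
    le_antisymm (by linarith) (Finset.sum_nonneg fun j _ => sq_nonneg _)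
  refine hA (funext fun j => ?_)
  rw [Finset.sum_eq_zero_iff_of_nonneg fun j _ => sq_nonneg _] at h4
  exact sub_eq_zero.1 (pow_eq_zero_iff two_ne_zero |>.1 (h4 j (Finset.mem_univ j)))

theorem lsLoss_le_iff (hΔ : IsSimplicialPolytopalFan Δ) (hv : IsRayGenerators Δ v)
    {Q Q' : Set (EuclideanSpace ℝ (Fin d))} (hQ : Q ∈ deformationCone Δ)
    (hQ' : Q' ∈ deformationCone Δ) (U : Fin m → EuclideanSpace ℝ (Fin d)) (y : Fin m → ℝ) :
    lsLoss U y Q ≤ lsLoss U y Q' ↔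
      ∑ j, ((rayMatrix Δ v U).mulVec (fun i => supportFun Q (v i)) j - y j) ^ 2 ≤
        ∑ j, ((rayMatrix Δ v U).mulVec (fun i => supportFun Q' (v i)) j - y j) ^ 2 := by
  rw [lsLoss_eq hΔ hv hQ, lsLoss_eq hΔ hv hQ']
  -- For `m = 0` the factor cannot be cancelled, but both sums are empty.
  rcases Nat.eq_zero_or_pos m with rfl | hm
  · simp
  · exact mul_le_mul_iff_right₀ (by positivity)

theorem mem_uniqueDirections_iff (hΔ : IsSimplicialPolytopalFan Δ) (hv : IsRayGenerators Δ v)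
    (U : Fin m → EuclideanSpace ℝ (Fin d)) :
    U ∈ uniqueDirections m Δ ↔ Function.Injective (rayMatrix Δ v U).mulVec := by
  have hΔ' := hΔ
  obtain ⟨⟨P, hP, rfl⟩, -⟩ := hΔ'
  have hnhds := supportVectors_mem_nhds hP hΔ hv
  constructor
  · intro hU
    rw [← Matrix.coe_mulVecLin, ← LinearMap.ker_eq_bot, LinearMap.ker_eq_bot']
    intro g hg
    set h₀ : Fin n → ℝ := fun i => supportFun P (v i)
    have hc : Continuous fun t : ℝ => h₀ + t • g := by fun_prop
    have h0 : supportVectors (normalFan P) v ∈ nhds (h₀ + (0 : ℝ) • g) := by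
      simpa using hnhds
    have hev := (hc.continuousAt.eventually h0).filter_mono
      (nhdsWithin_le_nhds (s := Set.Ioi (0 : ℝ)))
    obtain ⟨t, ht, ht0⟩ := (hev.and self_mem_nhdsWithin).exists
    obtain ⟨Q, hQ, hQh⟩ := mem_of_mem_nhds hnhds
    obtain ⟨Q', hQ', hQ'h⟩ := ht
    -- With data `A h₀` the minimal loss is zero, so `h₀` and `h₀ + t • g` both come from
    -- minimisers.
    obtain ⟨R, hR⟩ := Set.encard_eq_one.1 (hU ((rayMatrix (normalFan P) v U).mulVec h₀))
    have hmin : ∀ S ∈ deformationCone (normalFan P),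
        (rayMatrix (normalFan P) v U).mulVec (fun i => supportFun S (v i)) =
          (rayMatrix (normalFan P) v U).mulVec h₀ → S = R := by
      intro S hS hSh
      have : S ∈ lsEstimator (normalFan P) U ((rayMatrix (normalFan P) v U).mulVec h₀) := by
        refine ⟨hS, fun T hT => (lsLoss_le_iff hΔ hv hS hT _ _).2 ?_⟩
        rw [hSh]
        simpa using Finset.sum_nonneg fun j _ => sq_nonneg _
      rw [hR] at this
      exact this
    have hg' : (rayMatrix (normalFan P) v U).mulVec g = 0 := hg
    have h1 := hmin Q hQ (by rw [funext hQh])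
    have h2 := hmin Q' hQ' (by
      rw [funext hQ'h, Matrix.mulVec_add, Matrix.mulVec_smul, hg', smul_zero, add_zero])
    have h3 : h₀ = h₀ + t • g :=
      funext fun i => by rw [← hQh, ← hQ'h, h1, h2]
    have h4 : t • g = 0 := by simpa using h3
    exact (smul_eq_zero.1 h4).resolve_left (ne_of_gt ht0)
  · intro hA y
    obtain ⟨h, ⟨Q, hQ, hQh⟩, hmin⟩ := exists_isMinOn_sum_sq hA (isClosed_supportVectors hΔ hv)
      ⟨_, mem_of_mem_nhds hnhds⟩ y
    refine Set.encard_eq_one.2 ⟨Q, Set.eq_singleton_iff_unique_mem.2 ⟨⟨hQ, fun T hT => ?_⟩, ?_⟩⟩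
    · rw [lsLoss_le_iff hΔ hv hQ hT, funext hQh]
      exact hmin _ ⟨T, hT, fun i => rfl⟩
    · rintro T ⟨hT, hTmin⟩
      refine eq_of_supportFun_eq hΔ hv hT hQ fun i => ?_
      refine congrFun (eq_of_isMinOn_sum_sq hA (convex_supportVectors hΔ hv)
        (f := fun i => supportFun T (v i)) (g := fun i => supportFun Q (v i)) (y := y)
        ⟨T, hT, fun i => rfl⟩ ⟨Q, hQ, fun i => rfl⟩ ?_ ?_) i
      · rintro g ⟨S, hS, hSg⟩
        rw [← funext hSg]
        exact (lsLoss_le_iff hΔ hv hT hS U y).1 (hTmin S hS)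
      · rw [funext hQh]
        exact hmin

end LeastSquares

/-! ### Matchings, Hall's theorem and generic nonvanishing of minors. -/

section Matching

variable {d n m : ℕ} {Δ : Set (PointedCone ℝ (EuclideanSpace ℝ (Fin d)))}
  {v : Fin n → EuclideanSpace ℝ (Fin d)}

theorem directionGraph_adj_inl_inr {U : Fin m → EuclideanSpace ℝ (Fin d)} {i : Fin n}
    {j : Fin m} : (directionGraph Δ v U).Adj (Sum.inl i) (Sum.inr j) ↔
      0 < rayCoords Δ v (U j) i := by
  simp [directionGraph]

theorem not_directionGraph_adj_inl_inl {U : Fin m → EuclideanSpace ℝ (Fin d)} {i i' : Fin n} :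
    ¬ (directionGraph Δ v U).Adj (Sum.inl i) (Sum.inl i') := by
  simp [directionGraph]

theorem not_directionGraph_adj_inr_inr {U : Fin m → EuclideanSpace ℝ (Fin d)} {j j' : Fin m} :
    ¬ (directionGraph Δ v U).Adj (Sum.inr j) (Sum.inr j') := by
  simp [directionGraph]

/-- A matching of size `n` in the bipartite graph on `[n] ⊔ [m]` is an injection `[n] → [m]` along
edges. -/
theorem hasMatchingOfSize_directionGraph_iff {U : Fin m → EuclideanSpace ℝ (Fin d)} :
    HasMatchingOfSize (directionGraph Δ v U) n ↔
      ∃ f : Fin n → Fin m, Function.Injective f ∧ ∀ i, 0 < rayCoords Δ v (U (f i)) i := by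
  constructor
  · rintro ⟨M, hM, hcard⟩
    have hedge : ∀ e : M.edgeSet, ∃ i j, e.1 = s(Sum.inl i, Sum.inr j) := by
      rintro ⟨e, he⟩
      induction e using Sym2.ind with
      | _ a b =>
        have hab := M.adj_sub (SimpleGraph.Subgraph.mem_edgeSet.1 he)
        rcases a with i | j <;> rcases b with i' | j'
        · exact absurd hab not_directionGraph_adj_inl_inl
        · exact ⟨i, j', rfl⟩
        · exact ⟨i', j, Sym2.eq_swap⟩
        · exact absurd hab not_directionGraph_adj_inr_inr
    choose p q hpq using hedge
    have hadj : ∀ e, M.Adj (Sum.inl (p e)) (Sum.inr (q e)) := fun e =>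
      SimpleGraph.Subgraph.mem_edgeSet.1 (hpq e ▸ e.2)
    have hinj : Function.Injective p := by
      intro e e' hee'
      have h5 := hM.eq_of_adj_left (hadj e) (hee' ▸ hadj e')
      exact Subtype.ext (by rw [hpq e, hpq e', h5, hee'])
    -- An injection from `n` edges into `[n]` is onto, so every `i` is matched.
    have himg : p '' Set.univ = Set.univ := by
      refine Set.Finite.eq_of_subset_of_encard_le (Set.toFinite _) (Set.subset_univ _) ?_
      have h6 : (Set.univ : Set M.edgeSet).encard = n := by
        rw [Set.encard_univ]
        exact hcard
      rw [hinj.injOn.encard_image, h6]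
      simp
    have hex : ∀ i, ∃ j, M.Adj (Sum.inl i) (Sum.inr j) := by
      intro i
      obtain ⟨e, -, rfl⟩ : i ∈ p '' Set.univ := himg ▸ Set.mem_univ i
      exact ⟨q e, hadj e⟩
    choose f hf using hex
    refine ⟨f, fun i i' hii' => ?_, fun i => directionGraph_adj_inl_inr.1 (M.adj_sub (hf i))⟩
    have := hM.eq_of_adj_right (hf i) (hii' ▸ hf i')
    exact Sum.inl.inj this
  · rintro ⟨f, hf, hpos⟩
    have hadj : ∀ i, (directionGraph Δ v U).Adj (Sum.inl i) (Sum.inr (f i)) := fun i =>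
      directionGraph_adj_inl_inr.2 (hpos i)
    let M : (directionGraph Δ v U).Subgraph :=
      { verts := Set.range Sum.inl ∪ Set.range fun i => Sum.inr (f i)
        Adj := fun a b => ∃ i, (a = Sum.inl i ∧ b = Sum.inr (f i)) ∨
          (a = Sum.inr (f i) ∧ b = Sum.inl i)
        adj_sub := by
          rintro a b ⟨i, ⟨rfl, rfl⟩ | ⟨rfl, rfl⟩⟩
          · exact hadj i
          · exact (hadj i).symm
        edge_vert := by
          rintro a b ⟨i, ⟨rfl, rfl⟩ | ⟨rfl, rfl⟩⟩
          · exact Or.inl ⟨i, rfl⟩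
          · exact Or.inr ⟨i, rfl⟩
        symm := ⟨by
          rintro a b ⟨i, h | h⟩
          · exact ⟨i, Or.inr ⟨h.2, h.1⟩⟩
          · exact ⟨i, Or.inl ⟨h.2, h.1⟩⟩⟩ }
    refine ⟨M, ?_, ?_⟩
    · rintro a (⟨i, rfl⟩ | ⟨i, rfl⟩)
      · refine ⟨Sum.inr (f i), ⟨i, Or.inl ⟨rfl, rfl⟩⟩, ?_⟩
        rintro b ⟨k, ⟨h1, rfl⟩ | ⟨h1, -⟩⟩
        · rw [Sum.inl.inj h1]
        · exact absurd h1 (by simp)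
      · refine ⟨Sum.inl i, ⟨i, Or.inr ⟨rfl, rfl⟩⟩, ?_⟩
        rintro b ⟨k, ⟨h1, -⟩ | ⟨h1, rfl⟩⟩
        · exact absurd h1 (by simp)
        · rw [hf (Sum.inr.inj h1)]
    · have hset : M.edgeSet = Set.range fun i => s(Sum.inl i, Sum.inr (f i)) := by
        ext e
        induction e using Sym2.ind with
        | _ a b =>
          rw [SimpleGraph.Subgraph.mem_edgeSet]
          constructor
          · rintro ⟨i, ⟨rfl, rfl⟩ | ⟨rfl, rfl⟩⟩
            · exact ⟨i, rfl⟩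
            · exact ⟨i, Sym2.eq_swap⟩
          · rintro ⟨i, h⟩
            rcases Sym2.eq_iff.1 h with ⟨rfl, rfl⟩ | ⟨rfl, rfl⟩
            · exact ⟨i, Or.inl ⟨rfl, rfl⟩⟩
            · exact ⟨i, Or.inr ⟨rfl, rfl⟩⟩
      have hinj : Function.Injective fun i => s((Sum.inl i : Fin n ⊕ Fin m), Sum.inr (f i)) := by
        intro i i' h
        rcases Sym2.eq_iff.1 h with ⟨h1, -⟩ | ⟨h1, -⟩
        · exact Sum.inl.inj h1
        · exact absurd h1 (by simp)
      rw [hset, ← Set.image_univ, hinj.injOn.encard_image]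
      simp

/-- The support of an injective matrix contains a matching saturating the columns. -/
theorem Matrix.exists_injective_ne_zero_of_mulVec_injective {A : Matrix (Fin m) (Fin n) ℝ}
    (hA : Function.Injective A.mulVec) :
    ∃ f : Fin n → Fin m, Function.Injective f ∧ ∀ i, A (f i) i ≠ 0 := by
  classical
  refine (Fintype.all_card_le_filter_rel_iff_exists_injective fun i j => A j i ≠ 0).1 fun S => ?_
  set N : Finset (Fin m) := Finset.univ.filter fun j => ∃ i ∈ S, A j i ≠ 0 with hN
  -- Rows outside `N` vanish on the columns in `S`, so the `N × S` block inherits injectivity;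
  -- comparing dimensions gives Hall's condition.
  let L : (S → ℝ) →ₗ[ℝ] (N → ℝ) := (A.submatrix (fun j : N => j.1) (fun i : S => i.1)).mulVecLin
  have hL : Function.Injective L := by
    rw [← LinearMap.ker_eq_bot, LinearMap.ker_eq_bot']
    intro g hg
    set g' : Fin n → ℝ := fun i => if h : i ∈ S then g ⟨i, h⟩ else 0 with hg'
    have hsum : ∀ j, A.mulVec g' j = ∑ i : S, A j i * g i := by
      intro j
      rw [Matrix.mulVec, dotProduct, ← Finset.sum_subset (Finset.subset_univ S)
        (fun i _ hi => by simp [hg', hi]), ← Finset.sum_coe_sort S]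
      refine Finset.sum_congr rfl fun i _ => ?_
      simp [hg']
    have hzero : A.mulVec g' = A.mulVec 0 := by
      rw [Matrix.mulVec_zero]
      funext j
      rw [hsum, Pi.zero_apply]
      by_cases hj : j ∈ N
      · exact congrFun hg ⟨j, hj⟩
      · refine Finset.sum_eq_zero fun i _ => ?_
        have : A j i = 0 := by
          by_contra h
          exact hj (by rw [hN, Finset.mem_filter]; exact ⟨Finset.mem_univ _, i, i.2, h⟩)
        rw [this, zero_mul]
    have := hA hzero
    funext i
    have := congrFun this i
    simpa [hg'] using this
  have := LinearMap.finrank_le_finrank_of_injective hL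
  simpa using this

theorem Matrix.mulVec_injective_of_det_submatrix_ne_zero {A : Matrix (Fin m) (Fin n) ℝ}
    {f : Fin n → Fin m} (h : (A.submatrix f id).det ≠ 0) : Function.Injective A.mulVec := by
  have h1 : Function.Injective (A.submatrix f id).mulVec :=
    Matrix.mulVec_injective_iff_isUnit.2 ((Matrix.isUnit_iff_isUnit_det _).2 h.isUnit)
  intro a b hab
  refine h1 (funext fun i => ?_)
  exact congrFun hab (f i)

/-- The square matrix whose `i`-th row consists of the coordinates of `U (f i)` with respect to the
generators of the cone with index set `J (f i)`. -/
noncomputable def coneCoordMatrix (v : Fin n → EuclideanSpace ℝ (Fin d))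
    (J : Fin m → Finset (Fin n)) (f : Fin n → Fin m) (U : Fin m → EuclideanSpace ℝ (Fin d)) :
    Matrix (Fin n) (Fin n) ℝ :=
  Matrix.of fun k i => coneCoord v (J (f k)) (U (f k)) i

theorem ae_det_coneCoordMatrix_ne_zero {J : Fin m → Finset (Fin n)} {f : Fin n → Fin m}
    (hJ : ∀ j, LinearIndepOn ℝ v (J j : Set (Fin n))) (hf : Function.Injective f)
    (hfJ : ∀ i, i ∈ J (f i)) :
    ∀ᵐ U ∂(volume : Measure (Fin m → EuclideanSpace ℝ (Fin d))),
      (coneCoordMatrix v J f U).det ≠ 0 := by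
  classical
  have hcont : Continuous fun U : Fin m → EuclideanSpace ℝ (Fin d) =>
      (coneCoordMatrix v J f U).det := by
    refine Continuous.matrix_det (continuous_matrix fun k i => ?_)
    exact (continuous_apply i).comp
      ((coneCoord v (J (f k))).continuous_of_finiteDimensional.comp (continuous_apply (f k)))
  -- Row `f i` of `W` is `v i`, whose cone coordinates are the `i`-th unit vector because `i ∈ J (f
  -- i)`. Hence adding `t • W` adds `t` times the identity, and the determinant becomes a
  -- characteristic polynomial in `t`.
  obtain ⟨W, hW⟩ : ∃ W : Fin m → EuclideanSpace ℝ (Fin d), ∀ i, W (f i) = v i :=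
    ⟨Function.extend f v 0, fun i => hf.extend_apply _ _ _⟩
  refine ae_mem_of_ae_add_linearMap_mem (LinearMap.toSpanSingleton ℝ _ W) volume volume
    (s := {U | (coneCoordMatrix v J f U).det ≠ 0})
    (isOpen_ne_fun hcont continuous_const).measurableSet fun U => ?_
  have hdet : ∀ t : ℝ, (coneCoordMatrix v J f (U + t • W)).det =
      (-coneCoordMatrix v J f U).charpoly.eval t := by
    intro t
    rw [Matrix.eval_charpoly]
    congr 1
    ext k i
    have h1 := congrFun ((coneCoord_spec (hJ (f k))).1 k (hfJ k)) i
    simp only [coneCoordMatrix, Matrix.of_apply, Pi.add_apply, Pi.smul_apply, map_add, map_smul,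
      hW, h1, smul_eq_mul, Matrix.sub_apply, Matrix.neg_apply, Matrix.scalar_apply,
      Matrix.diagonal_apply, Pi.single_apply]
    rcases eq_or_ne i k with rfl | hik
    · simp [add_comm]
    · simp [hik, hik.symm]
  have hfin : {t : ℝ | (-coneCoordMatrix v J f U).charpoly.eval t = 0}.Finite := by
    refine ((-coneCoordMatrix v J f U).charpoly.roots.toFinset.finite_toSet).subset fun t ht => ?_
    simpa [(Matrix.charpoly_monic _).ne_zero] using ht
  filter_upwards [hfin.measure_zero volume |> measure_eq_zero_iff_ae_notMem.1] with t ht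
  change (coneCoordMatrix v J f (U + t • W)).det ≠ 0
  rw [hdet]
  exact ht

end Matching

theorem theorem3p8 (d n m : ℕ)
    (Δ : Set (PointedCone ℝ (EuclideanSpace ℝ (Fin d)))) (hΔ : IsSimplicialPolytopalFan Δ)
    (v : Fin n → EuclideanSpace ℝ (Fin d)) (hv : IsRayGenerators Δ v) :
    (n ≤ m → (interior (uniqueDirections m Δ)).Nonempty) ∧
      ∀ᵐ U ∂(volume : Measure (Fin m → EuclideanSpace ℝ (Fin d))),
        U ∈ uniqueDirections m Δ ↔ HasMatchingOfSize (directionGraph Δ v U) n := by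
  classical
  constructor
  · intro hnm
    set f : Fin n → Fin m := Fin.castLE hnm
    have hf : Function.Injective f := Fin.castLE_injective hnm
    have hcont : Continuous fun U : Fin m → EuclideanSpace ℝ (Fin d) =>
        ((rayMatrix Δ v U).submatrix f id).det := by
      refine Continuous.matrix_det (continuous_matrix fun k i => ?_)
      exact (continuous_apply i).comp
        ((hv.continuous_rayCoords hΔ).comp (continuous_apply (f k)))
    refine ⟨Function.extend f v 0, mem_interior.2
      ⟨{U | ((rayMatrix Δ v U).submatrix f id).det ≠ 0}, fun U hU => ?_,
        isOpen_ne_fun hcont continuous_const, ?_⟩⟩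
    · exact (mem_uniqueDirections_iff hΔ hv U).2
        (Matrix.mulVec_injective_of_det_submatrix_ne_zero hU)
    · have h1 : (rayMatrix Δ v (Function.extend f v 0)).submatrix f id = 1 := by
        ext k i
        simp only [rayMatrix, Matrix.submatrix_apply, Matrix.of_apply, hf.extend_apply, id,
          hv.rayCoords_generator hΔ, Matrix.one_apply, Pi.single_apply, eq_comm]
      change ((rayMatrix Δ v (Function.extend f v 0)).submatrix f id).det ≠ 0
      rw [h1, Matrix.det_one]
      exact one_ne_zero
  -- The cones containing the rows depend on `U`, so the finitely many pairs `(J, f)` are all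
  -- excluded in advance.
  · have hae : ∀ᵐ U ∂(volume : Measure (Fin m → EuclideanSpace ℝ (Fin d))),
        ∀ (J : Fin m → Finset (Fin n)) (f : Fin n → Fin m),
          (∀ j, LinearIndepOn ℝ v (J j : Set (Fin n))) → Function.Injective f →
            (∀ i, i ∈ J (f i)) → (coneCoordMatrix v J f U).det ≠ 0 := by
      simp only [ae_all_iff]
      exact fun J f hJ hf hfJ => ae_det_coneCoordMatrix_ne_zero hJ hf hfJ
    filter_upwards [hae] with U hU
    rw [mem_uniqueDirections_iff hΔ hv, hasMatchingOfSize_directionGraph_iff]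
    constructor
    · intro hA
      obtain ⟨f, hf, hne⟩ := Matrix.exists_injective_ne_zero_of_mulVec_injective hA
      exact ⟨f, hf, fun i => lt_of_le_of_ne (hv.rayCoords_nonneg hΔ _ i) (Ne.symm (hne i))⟩
    · rintro ⟨f, hf, hpos⟩
      choose J hJ using fun j => hv.isPosCoords_rayCoords hΔ (U j)
      refine Matrix.mulVec_injective_of_det_submatrix_ne_zero (f := f) ?_
      have heq : (rayMatrix Δ v U).submatrix f id = coneCoordMatrix v J f U := by
        ext k i
        simp only [rayMatrix, coneCoordMatrix, Matrix.submatrix_apply, Matrix.of_apply, id,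
          hv.rayCoords_eq_coneCoord hΔ (hJ (f k)).hull_mem (hJ (f k)).mem_hull]
      rw [heq]
      refine hU J f (fun j => hv.linearIndepOn hΔ (hJ j).hull_mem) hf fun i => ?_
      by_contra hi
      exact (hpos i).ne' ((hJ (f i)).eq_zero i hi)
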